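/- Let $w=\{w_{ij}\}_{i,j\ge 1}$ be independent real random variables on a probability space $(\Omega_w,\mathcal F_w,\mathbb P_w)$ with $$\mathbb E_w w_{ij}=0,\qquad \mathbb E_w w_{ij}^2=1,\qquad \mathbb E_w|w_{ij}|^{p}\le K\qquad\text{for all } i,j\ge1,$$ for some $p>12$ and $K>0$ (the $w_{ij}$ need not be identically distributed). Fix $\beta\in(0,1)$. For $N\ge 1$ put $B=\lfloor \beta N\rfloor$ and let $$\Sigma_{N,N}=\bigl\{(i,j)\in\{1,\dots,N\}^2:\ \max(|i-N/2|,|j-N/2|)\ge B/2\bigr\},$$ the $N\times N$ square with a central square hole removed. An up-right path from $(1,1)$ to $(N,N)$ is a sequence of $2N-1$ squares in $\mathbb Z_{\ge1}^2$ that starts at $(1,1)$, ends at $(N,N)$, and each of whose steps is $(1,0)$ or $(0,1)$. For all sufficiently large $N$ there are such paths that remain in $\Sigma_{N,N}$; let $\sigma=\sigma_N$ be chosen uniformly at random from them, independently of $w$, and let $\mathbb P_\sigma$ denote the law of $\sigma$. Then for $\mathbb P_w$-almost every environment $w$, $$\frac{1}{\sqrt{2N-1}}\sum_{(i,j)\in\sigma}w_{ij}\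 \xrightarrow{\ \mathscr D\ }\ \mathscr N(0,1),\qquad N\to\infty,$$ where the convergence in distribution to the standard normal law is with respect to $\mathbb P_\sigma$, with $w$ held fixed. -/

import Mathlib

open MeasureTheory ProbabilityTheory Filter Topology

noncomputable section

/-- Every set of positive integers is measurable. -/
instance instMeasurableSpacePNatTop : MeasurableSpace ℕ+ := ⊤

instance instDiscreteMeasurableSpacePNat : DiscreteMeasurableSpace ℕ+ :=
  ⟨fun _ => MeasurableSpace.measurableSet_top⟩

/-- Up-right lattice paths from `(1, 1)` to `(M, N)` in the positive quadrant: the sequence of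
the `M + N - 1` visited squares, in order. (A path visits each square at most once and is
determined by the set of squares that it visits, so these sequences are in bijection with the
paths regarded as sets of squares.) -/
structure IsUpRightPath (M N : ℕ) (σ : Fin (M + N - 1) → ℕ+ × ℕ+) : Prop where
  /-- the first square is `(1, 1)` -/
  start : ∀ k : Fin (M + N - 1), (k : ℕ) = 0 → σ k = (1, 1)
  /-- the last square is `(M, N)` -/
  finish : ∀ k : Fin (M + N - 1), (k : ℕ) + 2 = M + N →
    ((σ k).1 : ℕ) = M ∧ ((σ k).2 : ℕ) = N
  /-- each step is horizontal, `(1, 0)`, or vertical, `(0, 1)` -/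
  step : ∀ k l : Fin (M + N - 1), (l : ℕ) = (k : ℕ) + 1 →
    σ l = ((σ k).1 + 1, (σ k).2) ∨ σ l = ((σ k).1, (σ k).2 + 1)

/-- The square `{1, …, N}²` with a central square hole of side `B = ⌊β N⌋` removed:
all `(i, j)` with `1 ≤ i, j ≤ N` and `max (|i - N/2|, |j - N/2|) ≥ B/2`. -/
def holeDomain (β : ℝ) (N : ℕ) : Set (ℕ+ × ℕ+) :=
  {a | (a.1 : ℕ) ≤ N ∧ (a.2 : ℕ) ≤ N ∧
    (⌊β * (N : ℝ)⌋₊ : ℝ) / 2 ≤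
      max |((a.1 : ℕ) : ℝ) - (N : ℝ) / 2| |((a.2 : ℕ) : ℝ) - (N : ℝ) / 2|}

/-- The up-right paths from `(1, 1)` to `(N, N)` that avoid the hole. -/
def holePaths (β : ℝ) (N : ℕ) : Set (Fin (N + N - 1) → ℕ+ × ℕ+) :=
  {σ | IsUpRightPath N N σ ∧ ∀ k, σ k ∈ holeDomain β N}

/-- The energy of a path in the environment `w`: the sum of the weights along the path. -/
def pathEnergy {n : ℕ} (w : ℕ+ × ℕ+ → ℝ) (σ : Fin n → ℕ+ × ℕ+) : ℝ :=
  ∑ k, w (σ k)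

/-- The quenched law, in the fixed environment `w`, of the rescaled energy
`(2N - 1)^{-1/2} ∑_{(i,j) ∈ σ} w_{ij}` of a path `σ` chosen uniformly among those avoiding the
hole. It is a probability measure as soon as there is such a path. For the (finitely many) `N`
without any such path it is the zero measure. -/
def quenchedLaw (β : ℝ) (w : ℕ+ × ℕ+ → ℝ) (N : ℕ) : FiniteMeasure ℝ :=
  ⟨(uniformOn (holePaths β N)).map
    (fun σ => (1 / Real.sqrt (2 * (N : ℝ) - 1)) * pathEnergy w σ), inferInstance⟩

/-- The standard normal distribution `N(0, 1)`. -/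
def stdNormal : FiniteMeasure ℝ := ⟨gaussianReal 0 1, inferInstance⟩

end

/-! By Lévy's continuity theorem it is enough that, for almost every environment, the quenched
characteristic function (the average over paths of exp(i t H / √(2N-1)), H being the energy) tends
to exp(-t²/2). Its expectation over the environment does: each path contributes a product of 2N-1
characteristic functions, each within O(N^(-3/2)) of the same Gaussian factor
(`tendsto_annealedExp`). What remains is concentration around this expectation.

Reveal the weights one square at a time. The average becomes a martingale whose increment at a
square a is a centred variable of order N^(-1/2), independent of the past, times a function of the
past bounded by the probability that a path visits a. Hence the sixth moment of the fluctuation is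
at most a constant times (N^(-1) ∑ₐ P(a ∈ σ)²)³ (`partialAverage_sixth_moment`), and ∑ₐ P(a ∈ σ)² is
the expected overlap of two independent paths.

This overlap is O(√N) (`exists_overlap_bound`). By monotonicity a path avoids the hole as soon as it
does so on the antidiagonal i + j = N. Given the crossing point, the steps before and after it form
independent uniform subsets of given sizes, so positions are hypergeometric. Crossing points near
the corners are exponentially unlikely; for the others a hypergeometric probability is at most of
the order of the inverse standard deviation (`hypergeometric_le`), and these bounds sum to O(√N)
along a path.

The sixth moments are therefore O(N^(-3/2)), which is summable, and convergence is almost sure for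
each fixed t. Fubini turns this into: almost surely, for almost every t. Since the limit is itself a
characteristic function, this already forces convergence at every t (`tendsto_charFun_of_ae`). -/

/-! ### Anticoncentration of hypergeometric distributions -/

/-- Moving one element from the second factor to the first. -/
lemma choose_mul_choose_shift (k l x y : ℕ) :
    k.choose (x + 1) * l.choose y * ((x + 1) * (l - y))
      = k.choose x * l.choose (y + 1) * ((k - x) * (y + 1)) := by
  have h1 := Nat.choose_succ_right_eq k x
  have h2 := Nat.choose_succ_right_eq l y
  calc _ = (k.choose (x + 1) * (x + 1)) * (l.choose y * (l - y)) := by ring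
    _ = (k.choose x * (k - x)) * (l.choose (y + 1) * (y + 1)) := by rw [h1, h2]
    _ = _ := by ring

/-- With e = 1/(8J), a shift by at most J changes a quantity of size at least 8J² by a relative
amount of at most e. The four factors together cost (1 - e)²/(1 + e)² ≥ 1 - 4e = 1 - 1/(2J). Applied
to the ratio of neighbouring hypergeometric weights, where the hypothesis `h` expresses that the
weights are maximal at the starting point. -/
lemma ratio_lower_bound {a b c d J j : ℝ} (hJ : 1 ≤ J) (hj0 : 0 ≤ j) (hj : j + 1 ≤ J)
    (ha : 8 * J ^ 2 ≤ a) (hb : 8 * J ^ 2 ≤ b) (hc : 8 * J ^ 2 ≤ c) (hd : 8 * J ^ 2 ≤ d)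
    (h : a * d ≤ (b + 1) * (c + 1)) :
    (1 - 1 / (2 * J)) * ((a + j + 1) * (d + j + 1)) ≤ (b - j) * (c - j) := by
  have hJ0 : 0 < J := by linarith
  obtain ⟨e, he⟩ : ∃ e, e = 1 / (8 * J) := ⟨_, rfl⟩
  have heJ : e * (8 * J) = 1 := by rw [he]; field_simp
  have he0 : 0 < e := by rw [he]; positivity
  have he1 : e ≤ 1 / 8 := by
    rw [he]; apply one_div_le_one_div_of_le <;> linarith
  have h4 : 1 - 1 / (2 * J) = 1 - 4 * e := by rw [he]; field_simp; ring
  have key : ∀ z, 8 * J ^ 2 ≤ z → J ≤ e * z := by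
    intro z hz
    calc J = e * (8 * J ^ 2) := by linear_combination (-J) * heJ
      _ ≤ e * z := by gcongr
  have hJ2 : (1 : ℝ) ≤ 8 * J ^ 2 := by nlinarith
  have hb' : (b + 1) * (1 - e) ≤ b - j := by linarith [key (b + 1) (by linarith)]
  have hc' : (c + 1) * (1 - e) ≤ c - j := by linarith [key (c + 1) (by linarith)]
  have ha' : a + j + 1 ≤ a * (1 + e) := by linarith [key a ha]
  have hd' : d + j + 1 ≤ d * (1 + e) := by linarith [key d hd]
  have ha0 : 0 ≤ a := by linarith
  have hd0 : 0 ≤ d := by linarith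
  rw [h4]
  calc (1 - 4 * e) * ((a + j + 1) * (d + j + 1))
      ≤ (1 - 4 * e) * ((a * (1 + e)) * (d * (1 + e))) := by
        apply mul_le_mul_of_nonneg_left _ (by linarith)
        apply mul_le_mul ha' hd' (by linarith) (by positivity)
    _ = (a * d) * ((1 - 4 * e) * (1 + e) ^ 2) := by ring
    _ ≤ (a * d) * (1 - e) ^ 2 := by
        apply mul_le_mul_of_nonneg_left _ (by positivity)
        nlinarith [sq_nonneg e, pow_pos he0 3]
    _ ≤ ((b + 1) * (c + 1)) * (1 - e) ^ 2 := by gcongr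
    _ = ((b + 1) * (1 - e)) * ((c + 1) * (1 - e)) := by ring
    _ ≤ (b - j) * (c - j) := by
        apply mul_le_mul hb' hc'
        · apply mul_nonneg <;> linarith
        · refine le_trans ?_ hb'
          apply mul_nonneg <;> linarith

/-- A mode of the hypergeometric distribution which is far from the boundary has small mass. -/
lemma hypergeometric_mode_le {k l x y J : ℕ} (hJ : 1 ≤ J)
    (hmax : ∀ x' y', x' + y' = x + y →
      k.choose x' * l.choose y' ≤ k.choose x * l.choose y)
    (hx : 8 * J ^ 2 ≤ x) (hb : 8 * J ^ 2 + x ≤ k) (hy : 8 * J ^ 2 ≤ y)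
    (hd : 8 * J ^ 2 + y ≤ l) :
    J * (k.choose x * l.choose y) ≤ 2 * (k + l).choose (x + y) := by
  have hJJ : J ≤ 8 * J ^ 2 := by nlinarith
  have hpos : 0 < k.choose x * l.choose y :=
    Nat.mul_pos (Nat.choose_pos (by omega)) (Nat.choose_pos (by omega))
  -- Maximality against the neighbour (x - 1, y + 1).
  have hbal : x * (l - y) ≤ (k - x + 1) * (y + 1) := by
    obtain ⟨z, rfl⟩ : ∃ z, x = z + 1 := ⟨x - 1, by omega⟩
    have h1 := choose_mul_choose_shift k l z y
    have h2 := hmax z (y + 1) (by ring)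
    have h3 : k - (z + 1) + 1 = k - z := by omega
    rw [h3]
    refine Nat.le_of_mul_le_mul_left ?_ hpos
    rw [h1]
    exact Nat.mul_le_mul_right _ h2
  -- Each move away from the mode costs a factor of at least 1 - 1/(2J); the product of j of them is
  -- at least 1 - j/(2J), hence at least 1/2 for j ≤ J.
  have hstep : ∀ j, j ≤ J → (1 - j / (2 * J) : ℝ) * (k.choose x * l.choose y : ℕ)
      ≤ (k.choose (x + j) * l.choose (y - j) : ℕ) := by
    intro j
    induction j with
    | zero => intro _; simp
    | succ j ih =>
      intro hj
      have ih := ih (by omega)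
      have h1 := choose_mul_choose_shift k l (x + j) (y - (j + 1))
      rw [show y - (j + 1) + 1 = y - j by omega] at h1
      have hr := ratio_lower_bound (a := x) (b := (k - x : ℕ)) (c := y) (d := (l - y : ℕ))
        (J := J) (j := j) (by exact_mod_cast hJ) (by positivity) (by exact_mod_cast hj)
        (by exact_mod_cast hx) (by exact_mod_cast (by omega : 8 * J ^ 2 ≤ k - x))
        (by exact_mod_cast hy) (by exact_mod_cast (by omega : 8 * J ^ 2 ≤ l - y))
        (by exact_mod_cast hbal)
      have e1 : ((k - (x + j) : ℕ) : ℝ) = (k - x : ℕ) - j := by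
        rw [Nat.sub_add_eq, Nat.cast_sub (by omega)]
      have e2 : ((y - j : ℕ) : ℝ) = y - j := by rw [Nat.cast_sub (by omega)]
      have e3 : ((l - (y - (j + 1)) : ℕ) : ℝ) = (l - y : ℕ) + j + 1 := by
        rw [show l - (y - (j + 1)) = l - y + j + 1 by omega]; push_cast; ring
      set H := k.choose x * l.choose y
      set u := k.choose (x + j) * l.choose (y - j)
      set v := k.choose (x + (j + 1)) * l.choose (y - (j + 1))
      have h1' : (v : ℝ) * ((x + j + 1) * ((l - y : ℕ) + j + 1))
          = u * (((k - x : ℕ) - j) * (y - j)) := by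
        rw [← e1, ← e2, ← e3]
        exact_mod_cast h1
      have hJ' : (1 : ℝ) ≤ J := by exact_mod_cast hJ
      have hj' : (j : ℝ) + 1 ≤ J := by exact_mod_cast hj
      have hu : (1 - 1 / (2 * J) : ℝ) * u ≤ v := by
        have hp : (0 : ℝ) < (x + j + 1) * ((l - y : ℕ) + j + 1) := by positivity
        refine le_of_mul_le_mul_right ?_ hp
        rw [h1']
        calc (1 - 1 / (2 * J) : ℝ) * u * ((x + j + 1) * ((l - y : ℕ) + j + 1))
            = u * ((1 - 1 / (2 * J) : ℝ) * ((x + j + 1) * ((l - y : ℕ) + j + 1))) := by ring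
          _ ≤ _ := by gcongr
      refine le_trans ?_ hu
      have h0 : (0 : ℝ) ≤ 1 - 1 / (2 * J) := by
        rw [sub_nonneg, div_le_one (by linarith)]; linarith
      refine le_trans ?_ (mul_le_mul_of_nonneg_left ih h0)
      rw [← mul_assoc]
      apply mul_le_mul_of_nonneg_right _ (by positivity)
      have : (0 : ℝ) ≤ (1 / (2 * J)) * (j / (2 * J)) := by positivity
      push_cast
      have e : ((j : ℝ) + 1) / (2 * J) = j / (2 * J) + 1 / (2 * J) := by ring
      rw [e]; nlinarith
  have hhalf : ∀ j ∈ Finset.range J, (k.choose x * l.choose y)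
      ≤ 2 * (k.choose (x + j) * l.choose (y - j)) := by
    intro j hj
    have hj := Finset.mem_range.1 hj
    have h := hstep j hj.le
    have hJ' : (0 : ℝ) < J := by exact_mod_cast hJ
    have : (1 / 2 : ℝ) ≤ 1 - j / (2 * J) := by
      have : (j : ℝ) / (2 * J) ≤ 1 / 2 := by
        rw [div_le_iff₀ (by linarith)]
        have : (j : ℝ) ≤ J := by exact_mod_cast hj.le
        linarith
      linarith
    have h2 : (1 / 2 : ℝ) * (k.choose x * l.choose y : ℕ)
      ≤ (k.choose (x + j) * l.choose (y - j) : ℕ) :=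
      le_trans (mul_le_mul_of_nonneg_right this (by positivity)) h
    have h3 : ((k.choose x * l.choose y : ℕ) : ℝ)
      ≤ 2 * (k.choose (x + j) * l.choose (y - j) : ℕ) := by linarith
    exact_mod_cast h3
  -- J distinct terms of Vandermonde's sum are each at least half the mode.
  calc J * (k.choose x * l.choose y)
      = ∑ _j ∈ Finset.range J, k.choose x * l.choose y := by simp
    _ ≤ ∑ j ∈ Finset.range J, 2 * (k.choose (x + j) * l.choose (y - j)) :=
        Finset.sum_le_sum hhalf
    _ = 2 * ∑ j ∈ Finset.range J, (k.choose (x + j) * l.choose (y - j)) := by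
        rw [Finset.mul_sum]
    _ ≤ 2 * (k + l).choose (x + y) := by
        rw [Nat.add_choose_eq]
        refine Nat.mul_le_mul_left _ ?_
        rw [← Finset.sum_image (f := fun p : ℕ × ℕ => k.choose p.1 * l.choose p.2)
          (g := fun j => (x + j, y - j)) (s := Finset.range J)]
        · apply Finset.sum_le_sum_of_subset
          intro p hp
          obtain ⟨j, hj, rfl⟩ := Finset.mem_image.1 hp
          have := Finset.mem_range.1 hj
          simp only [Finset.HasAntidiagonal.mem_antidiagonal]
          omega
        · intro a _ b _ h
          simpa using (Prod.ext_iff.1 h).1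

/-- The mode of the hypergeometric distribution is close to its mean. -/
lemma mode_location {a b c d γ : ℝ} (ha : 0 ≤ a) (hb : 0 ≤ b) (hc : 0 ≤ c) (hd : 0 ≤ d)
    (h : b * c ≤ (a + 1) * (d + 1))
    (hγ : γ * (a + b + c + d + 2) ≤ a + c + 1) : γ * (a + b + 1) ≤ a + 1 := by
  have hm : 0 < a + b + c + d + 2 := by linarith
  refine le_of_mul_le_mul_right ?_ hm
  calc γ * (a + b + 1) * (a + b + c + d + 2)
      = (a + b + 1) * (γ * (a + b + c + d + 2)) := by ring
    _ ≤ (a + b + 1) * (a + c + 1) := by gcongr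
    _ ≤ (a + 1) * (a + b + c + d + 2) := by nlinarith

/-- Every weight is at most the weight of the mode, and the mode divides both groups in proportions
bounded away from 0 and 1 (`mode_location`), so its distance to the boundary is of order γ(k + 1),
where k is the smaller group. This leaves room for J of order √(γ(k + 1)) in
`hypergeometric_mode_le`. -/
lemma hypergeometric_le_of_le {γ : ℝ} (hγ : 0 < γ) {k l x y : ℕ} (hkl : k ≤ l)
    (h1 : γ * (k + l + 2) ≤ x + y + 1) (h2 : γ * (k + l + 2) ≤ k + l - (x + y) + 1) :
    ((k.choose x * l.choose y : ℕ) : ℝ) * √(k + 1) ≤ 16 / √γ * ((k + l).choose (x + y) : ℕ) := by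
  have hsγ : 0 < √γ := Real.sqrt_pos.2 hγ
  have htriv : ((k.choose x * l.choose y : ℕ) : ℝ) ≤ ((k + l).choose (x + y) : ℕ) := by
    norm_cast
    rw [Nat.add_choose_eq]
    exact Finset.single_le_sum (f := fun p : ℕ × ℕ => k.choose p.1 * l.choose p.2)
      (fun _ _ => Nat.zero_le _) (Finset.HasAntidiagonal.mem_antidiagonal.2 (rfl : (x, y).1 + (x, y).2 = x + y))
  have hsplit : √(γ * (k + 1)) = √γ * √(k + 1) := Real.sqrt_mul hγ.le _
  -- For small k a probability is at most 1, and that suffices.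
  by_cases hsmall : γ * (k + 1) < 16
  · have : √γ * √((k : ℝ) + 1) ≤ 16 := by
      rw [← hsplit, Real.sqrt_le_left (by norm_num)]; linarith
    have h3 : √((k : ℝ) + 1) ≤ 16 / √γ := by
      rw [le_div_iff₀ hsγ]; linarith
    calc _ ≤ ((k + l).choose (x + y) : ℝ) * (16 / √γ) := by gcongr
      _ = _ := by ring
  · push Not at hsmall
    obtain ⟨⟨x₀, y₀⟩, hmem, hmax⟩ := Finset.exists_max_image (Finset.HasAntidiagonal.antidiagonal (x + y))
      (fun p : ℕ × ℕ => k.choose p.1 * l.choose p.2) ⟨(x, y), by simp⟩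
    rw [Finset.HasAntidiagonal.mem_antidiagonal] at hmem
    dsimp only at hmem hmax
    have hmax' : ∀ x' y', x' + y' = x₀ + y₀ →
        k.choose x' * l.choose y' ≤ k.choose x₀ * l.choose y₀ := fun x' y' h =>
      hmax (x', y') (by rw [Finset.HasAntidiagonal.mem_antidiagonal]; exact h.trans hmem)
    have hle : k.choose x * l.choose y ≤ k.choose x₀ * l.choose y₀ := hmax' x y hmem.symm
    rcases Nat.eq_zero_or_pos (k.choose x₀ * l.choose y₀) with h0 | hpos
    · have : k.choose x * l.choose y = 0 := by omega
      rw [this]; simp; positivity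
    have hx₀ : x₀ ≤ k := by
      by_contra h; simp [Nat.choose_eq_zero_of_lt (not_le.1 h)] at hpos
    have hy₀ : y₀ ≤ l := by
      by_contra h; simp [Nat.choose_eq_zero_of_lt (not_le.1 h)] at hpos
    obtain ⟨b, rfl⟩ := Nat.exists_eq_add_of_le hx₀
    obtain ⟨d, rfl⟩ := Nat.exists_eq_add_of_le hy₀
    have hbal1 : x₀ * d ≤ (b + 1) * (y₀ + 1) := by
      rcases x₀ with _ | z
      · simp
      have h1 := choose_mul_choose_shift (z + 1 + b) (y₀ + d) z y₀
      have h2 := hmax' z (y₀ + 1) (by ring)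
      rw [show y₀ + d - y₀ = d by omega, show z + 1 + b - z = b + 1 by omega] at h1
      refine Nat.le_of_mul_le_mul_left ?_ hpos
      rw [h1]
      exact Nat.mul_le_mul_right _ h2
    have hbal2 : b * y₀ ≤ (x₀ + 1) * (d + 1) := by
      rcases y₀ with _ | z
      · simp
      have h1 := choose_mul_choose_shift (x₀ + b) (z + 1 + d) x₀ z
      have h2 := hmax' (x₀ + 1) z (by ring)
      rw [show x₀ + b - x₀ = b by omega, show z + 1 + d - z = d + 1 by omega] at h1
      refine Nat.le_of_mul_le_mul_left ?_ hpos
      rw [← h1]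
      exact Nat.mul_le_mul_right _ h2
    have hsum : (x : ℝ) + y = x₀ + y₀ := by exact_mod_cast hmem.symm
    have r1 : (x₀ * d : ℝ) ≤ (b + 1) * (y₀ + 1) := by exact_mod_cast hbal1
    have r2 : (b * y₀ : ℝ) ≤ (x₀ + 1) * (d + 1) := by exact_mod_cast hbal2
    have hkl' : (x₀ : ℝ) + b ≤ y₀ + d := by exact_mod_cast hkl
    push_cast at h1 h2 hsmall hsplit ⊢
    have p1 := mode_location (γ := γ) (Nat.cast_nonneg x₀) (Nat.cast_nonneg b)
      (Nat.cast_nonneg y₀) (Nat.cast_nonneg d) r2 (by linarith)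
    have p2 := mode_location (γ := γ) (Nat.cast_nonneg b) (Nat.cast_nonneg x₀)
      (Nat.cast_nonneg d) (Nat.cast_nonneg y₀) (by linarith) (by linarith)
    have p3 := mode_location (γ := γ) (Nat.cast_nonneg y₀) (Nat.cast_nonneg d)
      (Nat.cast_nonneg x₀) (Nat.cast_nonneg b) (by linarith) (by linarith)
    have p4 := mode_location (γ := γ) (Nat.cast_nonneg d) (Nat.cast_nonneg y₀)
      (Nat.cast_nonneg b) (Nat.cast_nonneg x₀) (by linarith) (by linarith)
    have hmono : γ * (x₀ + b + 1) ≤ γ * (y₀ + d + 1) := by gcongr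
    set q : ℝ := γ * (x₀ + b + 1) with hq
    have hs4 : 4 ≤ √q := by
      rw [Real.le_sqrt (by norm_num) (by linarith)]; linarith
    -- Then 8J² ≤ q/2 ≤ q - 1, which is below all four distances to the boundary, while √q < 4(J +
    -- 1) ≤ 8J. The factor 2 from the mode bound times this 8 is the constant 16.
    set J := ⌊√q / 4⌋₊ with hJdef
    have hJle : (J : ℝ) ≤ √q / 4 := Nat.floor_le (by positivity)
    have hJlt : √q / 4 < J + 1 := Nat.lt_floor_add_one _
    have hJ1 : 1 ≤ J := by rw [hJdef, Nat.one_le_floor_iff]; linarith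
    have hJ1' : (1 : ℝ) ≤ J := by exact_mod_cast hJ1
    have hJ2 : (8 * J ^ 2 : ℝ) ≤ q / 2 := by
      have : (J : ℝ) ^ 2 ≤ (√q / 4) ^ 2 := by gcongr
      rw [div_pow, Real.sq_sqrt (by linarith)] at this
      linarith
    have cx : 8 * J ^ 2 ≤ x₀ := by
      have : (8 * J ^ 2 : ℝ) ≤ x₀ := by linarith
      exact_mod_cast this
    have cb : 8 * J ^ 2 ≤ b := by
      have : (8 * J ^ 2 : ℝ) ≤ b := by linarith
      exact_mod_cast this
    have cy : 8 * J ^ 2 ≤ y₀ := by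
      have : (8 * J ^ 2 : ℝ) ≤ y₀ := by linarith
      exact_mod_cast this
    have cd : 8 * J ^ 2 ≤ d := by
      have : (8 * J ^ 2 : ℝ) ≤ d := by linarith
      exact_mod_cast this
    have hmode := hypergeometric_mode_le hJ1 hmax' cx (by omega) cy (by omega)
    rw [hmem] at hmode
    set H := (x₀ + b).choose x₀ * (y₀ + d).choose y₀
    set H' := (x₀ + b).choose x * (y₀ + d).choose y with hH'
    have hm' : (J : ℝ) * H ≤ 2 * ((x₀ + b + (y₀ + d)).choose (x + y) : ℕ) := by
      exact_mod_cast hmode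
    have hle' : (H' : ℝ) ≤ H := by exact_mod_cast hle
    rw [← Nat.cast_mul, ← hH', div_mul_eq_mul_div, le_div_iff₀ hsγ, mul_assoc,
      mul_comm (√_), ← hsplit]
    have : √q ≤ 8 * J := by linarith
    calc (H' : ℝ) * √q ≤ H * (8 * J) := by gcongr
      _ ≤ _ := by linarith

/-- Hypergeometric probabilities in the bulk are at most of the order of the inverse standard
deviation. -/
lemma hypergeometric_le {γ : ℝ} (hγ : 0 < γ) {k l x y : ℕ}
    (h1 : γ * (k + l + 2) ≤ x + y + 1) (h2 : γ * (k + l + 2) ≤ k + l - (x + y) + 1) :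
    ((k.choose x * l.choose y : ℕ) : ℝ)
      ≤ 16 / √γ * (1 / √(k + 1) + 1 / √(l + 1)) * ((k + l).choose (x + y) : ℕ) := by
  have hsγ : 0 < √γ := Real.sqrt_pos.2 hγ
  have hk : 0 < √((k : ℝ) + 1) := Real.sqrt_pos.2 (by positivity)
  have hl : 0 < √((l : ℝ) + 1) := Real.sqrt_pos.2 (by positivity)
  rcases le_total k l with hkl | hkl
  · have h := hypergeometric_le_of_le hγ hkl h1 h2
    rw [← le_div_iff₀ hk] at h
    refine h.trans ?_
    rw [div_eq_mul_one_div, mul_right_comm]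
    gcongr
    linarith [one_div_pos.2 hl]
  · have h := hypergeometric_le_of_le hγ hkl (x := y) (y := x) (by linarith) (by linarith)
    rw [← le_div_iff₀ hl, mul_comm (l.choose y), add_comm l k, add_comm y x] at h
    refine h.trans ?_
    rw [div_eq_mul_one_div, mul_right_comm]
    gcongr
    linarith [one_div_pos.2 hk]

/-! ### Counting hole-avoiding paths by their sets of horizontal steps -/

section Counting

open Finset

/-- The number of subsets of `{0, …, a + b + c - 1}` with prescribed numbers of elements in three
consecutive intervals. -/
lemma card_three_intervals (a b c x y z : ℕ) :
    #{R ∈ (range (a + b + c)).powerset | #(R ∩ range a) = x ∧ #(R ∩ range (a + b)) = x + y ∧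
        #R = x + y + z} = a.choose x * (b.choose y * c.choose z) := by
  have key : ∀ R ⊆ range (a + b + c), R ∩ range (a + b) = R ∩ range a ∪ R ∩ Ico a (a + b) ∧
      R = R ∩ range (a + b) ∪ R ∩ Ico (a + b) (a + b + c) := by
    intro R hR
    constructor
    · ext j
      simp only [mem_inter, mem_union, mem_range, mem_Ico, ← and_or_left]
      exact and_congr_right fun _ => by omega
    · ext j
      have := @hR j
      simp only [mem_inter, mem_union, mem_range, mem_Ico] at this ⊢
      constructor
      · intro h; have := this h; simp only [h, true_and]; omega
      · tauto
  have d1 : ∀ R : Finset ℕ, Disjoint (R ∩ range a) (R ∩ Ico a (a + b)) := fun R => by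
    rw [disjoint_left]; intro j; simp only [mem_inter, mem_range, mem_Ico]; omega
  have d2 : ∀ R : Finset ℕ, Disjoint (R ∩ range (a + b)) (R ∩ Ico (a + b) (a + b + c)) :=
    fun R => by
      rw [disjoint_left]; intro j; simp only [mem_inter, mem_range, mem_Ico]; omega
  have hcard : a.choose x * (b.choose y * c.choose z)
      = #((range a).powersetCard x ×ˢ ((Ico a (a + b)).powersetCard y ×ˢ
        (Ico (a + b) (a + b + c)).powersetCard z)) := by
    simp [card_product, card_powersetCard]
  rw [hcard]
  refine card_nbij' (fun R => (R ∩ range a, R ∩ Ico a (a + b), R ∩ Ico (a + b) (a + b + c)))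
    (fun p => p.1 ∪ p.2.1 ∪ p.2.2) ?_ ?_ ?_ ?_
  · intro R hR
    simp only [coe_filter, mem_powerset, Set.mem_ofPred_eq] at hR
    obtain ⟨hR, h1, h2, h3⟩ := hR
    obtain ⟨k1, k2⟩ := key R hR
    rw [k1, card_union_of_disjoint (d1 R)] at h2
    rw [k2, card_union_of_disjoint (d2 R), k1, card_union_of_disjoint (d1 R)] at h3
    simp only [coe_product, Set.mem_prod, mem_coe, mem_powersetCard]
    refine ⟨⟨inter_subset_right, h1⟩, ⟨inter_subset_right, by omega⟩, inter_subset_right, by omega⟩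
  · rintro ⟨R₁, R₂, R₃⟩ h
    simp only [coe_product, Set.mem_prod, mem_coe, mem_powersetCard] at h
    obtain ⟨⟨h1, c1⟩, ⟨h2, c2⟩, h3, c3⟩ := h
    have e1 : (R₁ ∪ R₂ ∪ R₃) ∩ range a = R₁ := by
      ext j
      have a1 := @h1 j; have a2 := @h2 j; have a3 := @h3 j
      simp only [mem_inter, mem_union, mem_range, mem_Ico] at a1 a2 a3 ⊢
      constructor
      · rintro ⟨(h | h) | h, hj⟩
        · exact h
        · have := a2 h; omega
        · have := a3 h; omega
      · intro h; exact ⟨Or.inl (Or.inl h), a1 h⟩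
    have e2 : (R₁ ∪ R₂ ∪ R₃) ∩ range (a + b) = R₁ ∪ R₂ := by
      ext j
      have a1 := @h1 j; have a2 := @h2 j; have a3 := @h3 j
      simp only [mem_inter, mem_union, mem_range, mem_Ico] at a1 a2 a3 ⊢
      constructor
      · rintro ⟨(h | h) | h, hj⟩
        · exact Or.inl h
        · exact Or.inr h
        · have := a3 h; omega
      · rintro (h | h)
        · exact ⟨Or.inl (Or.inl h), by have := a1 h; omega⟩
        · exact ⟨Or.inl (Or.inr h), by have := a2 h; omega⟩
    have dd1 : Disjoint R₁ R₂ := by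
      rw [disjoint_left]; intro j a1 a2
      have := h1 a1; have := h2 a2
      simp only [mem_range, mem_Ico] at *; omega
    have dd2 : Disjoint (R₁ ∪ R₂) R₃ := by
      rw [disjoint_left]; intro j a1 a3
      have := h3 a3
      rcases mem_union.1 a1 with a1 | a1
      · have := h1 a1; simp only [mem_range, mem_Ico] at *; omega
      · have := h2 a1; simp only [mem_Ico] at *; omega
    simp only [coe_filter, mem_powerset, Set.mem_ofPred_eq, e1, e2, c1, card_union_of_disjoint dd1,
      card_union_of_disjoint dd2, c2, c3, and_true]
    intro j hj
    rcases mem_union.1 hj with hj | hj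
    · rcases mem_union.1 hj with hj | hj
      · have := h1 hj; simp only [mem_range] at *; omega
      · have := h2 hj; simp only [mem_range, mem_Ico] at *; omega
    · have := h3 hj; simp only [mem_range, mem_Ico] at *; omega
  · intro R hR
    simp only [coe_filter, mem_powerset, Set.mem_ofPred_eq] at hR
    obtain ⟨k1, k2⟩ := key R hR.1
    dsimp only
    rw [← k1, ← k2]
  · rintro ⟨R₁, R₂, R₃⟩ h
    simp only [coe_product, Set.mem_prod, mem_coe, mem_powersetCard] at h
    obtain ⟨⟨h1, c1⟩, ⟨h2, c2⟩, h3, c3⟩ := h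
    simp only [Prod.mk.injEq]
    refine ⟨?_, ?_, ?_⟩ <;>
    · ext j
      have a1 := @h1 j; have a2 := @h2 j; have a3 := @h3 j
      simp only [mem_inter, mem_union, mem_range, mem_Ico] at a1 a2 a3 ⊢
      constructor
      · rintro ⟨(h | h) | h, hj⟩
        · first | exact h | (have := a1 h; omega)
        · first | exact h | (have := a2 h; omega)
        · first | exact h | (have := a3 h; omega)
      · intro h
        simp only [h, true_or, or_true, true_and]
        first | exact a1 h | exact a2 h | exact a3 h

/-- The sets of horizontal steps of the up-right paths from `(1, 1)` to `(m + 2, m + 2)` which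
avoid a central hole of side `B`: only the number of horizontal steps before the antidiagonal
matters. -/
def holeSteps (B m : ℕ) : Finset (Finset ℕ) :=
  {R ∈ (range (2 * m + 2)).powerset | #R = m + 1 ∧
    (2 * #(R ∩ range m) + B ≤ m ∨ m + B ≤ 2 * #(R ∩ range m))}

/-- The number of step sets crossing the antidiagonal after `i` horizontal steps. -/
def crossingWeight (m i : ℕ) : ℕ := m.choose i * (m + 2).choose (m + 1 - i)

lemma card_inter_range_le (R : Finset ℕ) (k : ℕ) : #(R ∩ range k) ≤ k := by
  simpa using card_le_card (inter_subset_right : R ∩ range k ⊆ range k)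

lemma card_inter_range_mono (R : Finset ℕ) {k l : ℕ} (h : k ≤ l) :
    #(R ∩ range k) ≤ #(R ∩ range l) :=
  card_le_card (inter_subset_inter_left (range_mono h))

lemma card_holeSteps_crossing {B m i : ℕ} (hi : 2 * i + B ≤ m ∨ m + B ≤ 2 * i) (him : i ≤ m) :
    #{R ∈ holeSteps B m | #(R ∩ range m) = i} = crossingWeight m i := by
  -- Two intervals are enough here, so the middle one is taken empty.
  have h := card_three_intervals m 0 (m + 2) i 0 (m + 1 - i)
  simp only [Nat.choose_self, one_mul] at h
  rw [crossingWeight, ← h, holeSteps, filter_filter]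
  congr 1
  ext R
  simp only [mem_filter, mem_powerset, add_zero, show m + (m + 2) = 2 * m + 2 by ring]
  refine and_congr_right fun _ => ?_
  constructor
  · rintro ⟨⟨h1, h2⟩, h3⟩; omega
  · rintro ⟨h1, h2, h3⟩; refine ⟨⟨by omega, by omega⟩, h1⟩

lemma card_holeSteps_crossing_eq_zero {B m i : ℕ} (hi : ¬ (2 * i + B ≤ m ∨ m + B ≤ 2 * i)) :
    #{R ∈ holeSteps B m | #(R ∩ range m) = i} = 0 := by
  rw [card_eq_zero, filter_eq_empty_iff]
  intro R hR h
  simp only [holeSteps, mem_filter] at hR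
  rw [h] at hR
  exact hi hR.2.2

/-- Once the crossing point i is fixed, the hole imposes nothing more: the first m steps are a
uniform i-subset of `range m`, and the number of horizontal steps up to time k ≤ m is
hypergeometric. The factor for the steps after time m cancels. -/
lemma card_crossing_le_of_le (B : ℕ) {m i k x : ℕ} (hk : k ≤ m) {γ : ℝ} (hγ : 0 < γ)
    (h1 : γ * (m + 4) ≤ i) (h2 : γ * (m + 4) ≤ m - i) (him : i ≤ m) :
    (#{R ∈ holeSteps B m | #(R ∩ range m) = i ∧ #(R ∩ range k) = x} : ℝ)
      ≤ 16 / √γ * (1 / √(k + 1) + 1 / √((m - k : ℕ) + 1))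
        * #{R ∈ holeSteps B m | #(R ∩ range m) = i} := by
  by_cases hi : 2 * i + B ≤ m ∨ m + B ≤ 2 * i
  swap
  · have h0 := card_holeSteps_crossing_eq_zero hi
    have : #{R ∈ holeSteps B m | #(R ∩ range m) = i ∧ #(R ∩ range k) = x} = 0 := by
      refine Nat.eq_zero_of_le_zero (h0 ▸ card_le_card ?_)
      exact monotone_filter_right _ fun R _ h => h.1
    rw [this, h0]; simp
  rw [card_holeSteps_crossing hi him]
  by_cases hx : x ≤ i
  swap
  · have : #{R ∈ holeSteps B m | #(R ∩ range m) = i ∧ #(R ∩ range k) = x} = 0 := by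
      rw [card_eq_zero, filter_eq_empty_iff]
      rintro R - ⟨h, h'⟩
      have := card_inter_range_mono R hk
      omega
    rw [this]; simp; positivity
  obtain ⟨y, rfl⟩ := Nat.exists_eq_add_of_le hx
  obtain ⟨l, rfl⟩ := Nat.exists_eq_add_of_le hk
  have hle : #{R ∈ holeSteps B (k + l) | #(R ∩ range (k + l)) = x + y ∧ #(R ∩ range k) = x}
      ≤ k.choose x * (l.choose y * (k + l + 2).choose (k + l + 1 - (x + y))) := by
    rw [← card_three_intervals]
    refine card_le_card fun R => ?_
    simp only [holeSteps, mem_filter, mem_powerset,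
      show k + l + (k + l + 2) = 2 * (k + l) + 2 by ring]
    rintro ⟨⟨h1, h2, h3⟩, h4, h5⟩
    exact ⟨h1, h5, h4, by omega⟩
  have hy := hypergeometric_le (k := k) (l := l) (x := x) (y := y) hγ
    (by push_cast at h1; nlinarith) (by push_cast at h2; nlinarith)
  rw [show k + l - k = l by omega, crossingWeight]
  have hle' := Nat.cast_le (α := ℝ).2 hle
  push_cast at hle' hy ⊢
  refine hle'.trans ?_
  rw [← mul_assoc, ← mul_assoc]
  gcongr

/-- The counterpart after the antidiagonal: the last m + 2 steps contain m + 1 - i horizontal ones,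
uniformly placed. The length m + 2 of this half is why the bulk condition is stated with m + 4. -/
lemma card_crossing_le_of_ge (B : ℕ) {m i k x : ℕ} (hk : k ≤ m + 2) {γ : ℝ} (hγ : 0 < γ)
    (h1 : γ * (m + 4) ≤ i) (h2 : γ * (m + 4) ≤ m - i) (him : i ≤ m) :
    (#{R ∈ holeSteps B m | #(R ∩ range m) = i ∧ #(R ∩ range (m + k)) = x} : ℝ)
      ≤ 16 / √γ * (1 / √(k + 1) + 1 / √((m + 2 - k : ℕ) + 1))
        * #{R ∈ holeSteps B m | #(R ∩ range m) = i} := by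
  by_cases hi : 2 * i + B ≤ m ∨ m + B ≤ 2 * i
  swap
  · have h0 := card_holeSteps_crossing_eq_zero hi
    have : #{R ∈ holeSteps B m | #(R ∩ range m) = i ∧ #(R ∩ range (m + k)) = x} = 0 := by
      refine Nat.eq_zero_of_le_zero (h0 ▸ card_le_card ?_)
      exact monotone_filter_right _ fun R _ h => h.1
    rw [this, h0]; simp
  rw [card_holeSteps_crossing hi him]
  by_cases hx : i ≤ x ∧ x ≤ m + 1
  swap
  · have : #{R ∈ holeSteps B m | #(R ∩ range m) = i ∧ #(R ∩ range (m + k)) = x} = 0 := by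
      rw [card_eq_zero, filter_eq_empty_iff]
      rintro R hR ⟨h, h'⟩
      have := card_inter_range_mono R (by omega : m ≤ m + k)
      have h3 : #(R ∩ range (m + k)) ≤ #R := card_le_card inter_subset_left
      simp only [holeSteps, mem_filter] at hR
      omega
    rw [this]; simp; positivity
  obtain ⟨hx1, hx2⟩ := hx
  obtain ⟨y, rfl⟩ := Nat.exists_eq_add_of_le hx1
  obtain ⟨z, hz⟩ := Nat.exists_eq_add_of_le hx2
  obtain ⟨l, hl⟩ := Nat.exists_eq_add_of_le hk
  have hle : #{R ∈ holeSteps B m | #(R ∩ range m) = i ∧ #(R ∩ range (m + k)) = i + y}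
      ≤ m.choose i * (k.choose y * l.choose z) := by
    rw [← card_three_intervals]
    refine card_le_card fun R => ?_
    simp only [holeSteps, mem_filter, mem_powerset,
      show m + k + l = 2 * m + 2 by omega]
    rintro ⟨⟨h1, h2, h3⟩, h4, h5⟩
    exact ⟨h1, h4, h5, by omega⟩
  have hz' : (m : ℝ) + 1 = i + y + z := by exact_mod_cast hz
  have hl' : (m : ℝ) + 2 = k + l := by exact_mod_cast hl
  have hy := hypergeometric_le (k := k) (l := l) (x := y) (y := z) hγ
    (by nlinarith) (by nlinarith)
  rw [show m + 2 - k = l by omega, crossingWeight, show m + 1 - i = y + z by omega, hl]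
  have hle' := Nat.cast_le (α := ℝ).2 hle
  push_cast at hle' hy ⊢
  refine hle'.trans ?_
  rw [mul_left_comm _ (m.choose i : ℝ)]
  gcongr

/-- The ratio of consecutive weights is (m - i)(m + 1 - i) / ((i + 1)(i + 2)); here the first
factors give at least 2 and the second ones at least 1. -/
lemma two_mul_crossingWeight_le {m i : ℕ} (h : 3 * i + 2 ≤ m) :
    2 * crossingWeight m i ≤ crossingWeight m (i + 1) := by
  have hs := choose_mul_choose_shift m (m + 2) i (m - i)
  rw [show m - i + 1 = m + 1 - i by omega, show m + 2 - (m - i) = i + 2 by omega] at hs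
  unfold crossingWeight
  rw [show m + 1 - (i + 1) = m - i by omega]
  have hp : 0 < (i + 1) * (i + 2) := by positivity
  refine Nat.le_of_mul_le_mul_right ?_ hp
  rw [hs, mul_comm 2, mul_assoc]
  refine Nat.mul_le_mul_left _ ?_
  rw [← mul_assoc]
  exact Nat.mul_le_mul (by omega) (by omega)

lemma pow_two_mul_crossingWeight_le {m i l : ℕ} (h : 3 * (i + l) ≤ m + 1) :
    2 ^ l * crossingWeight m i ≤ crossingWeight m (i + l) := by
  induction l with
  | zero => simp
  | succ l ih =>
    have := two_mul_crossingWeight_le (m := m) (i := i + l) (by omega)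
    calc 2 ^ (l + 1) * crossingWeight m i = 2 * (2 ^ l * crossingWeight m i) := by ring
      _ ≤ 2 * crossingWeight m (i + l) := Nat.mul_le_mul_left _ (ih (by omega))
      _ ≤ _ := this

lemma crossingWeight_symm {m i : ℕ} (h : i ≤ m) :
    crossingWeight m (m - i) = crossingWeight m i := by
  unfold crossingWeight
  rw [Nat.choose_symm h, ← Nat.choose_symm (n := m + 2) (by omega : m + 1 - i ≤ m + 2)]
  congr 2; omega

lemma card_crossing_le_crossingWeight (B : ℕ) {m i : ℕ} (him : i ≤ m) :
    #{R ∈ holeSteps B m | #(R ∩ range m) = i} ≤ crossingWeight m i := by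
  by_cases hi : 2 * i + B ≤ m ∨ m + B ≤ 2 * i
  · exact (card_holeSteps_crossing hi him).le
  · rw [card_holeSteps_crossing_eq_zero hi]; exact Nat.zero_le _

lemma card_holeSteps_eq_sum (B m : ℕ) (p : Finset ℕ → Prop) [DecidablePred p] :
    #{R ∈ holeSteps B m | p R}
      = ∑ i ∈ range (m + 1), #{R ∈ holeSteps B m | #(R ∩ range m) = i ∧ p R} := by
  rw [card_eq_sum_card_fiberwise (f := fun R => #(R ∩ range m)) (t := range (m + 1))]
  · refine sum_congr rfl fun i _ => ?_
    rw [filter_filter]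
    congr 2
    ext R
    exact and_comm
  · intro R _
    have := card_inter_range_le R m
    simp only [coe_range, Set.mem_Iio]
    omega

/-- Crossings i ≤ L are compared with i + L. The weight doubles at each of the L steps in between,
and 6L + B ≤ m ensures that i + L ≤ 2L still misses the hole. Reflection handles the opposite
corner, whence the factor 2. -/
lemma card_extreme_crossing_le {B m L : ℕ} (hL : 6 * L + B ≤ m) :
    2 ^ L * #{R ∈ holeSteps B m | #(R ∩ range m) ≤ L ∨ m ≤ #(R ∩ range m) + L}
      ≤ 2 * #(holeSteps B m) := by
  have hlow : ∑ i ∈ range (L + 1), crossingWeight m (i + L) ≤ #(holeSteps B m) := by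
    have e : ∀ i ∈ range (L + 1), crossingWeight m (i + L)
        = #{R ∈ {R ∈ holeSteps B m | #(R ∩ range m) ∈ (range (L + 1)).image (· + L)} |
            #(R ∩ range m) = i + L} := by
      intro i hi
      rw [mem_range] at hi
      rw [← card_holeSteps_crossing (B := B) (by omega) (by omega), filter_filter]
      congr 2
      ext R
      simp only [mem_image, mem_range]
      refine ⟨fun h => ⟨⟨i, hi, h.symm⟩, h⟩, fun h => h.2⟩
    rw [sum_congr rfl e, ← sum_image (g := fun i => i + L)
      (f := fun j => #{R ∈ {R ∈ holeSteps B m | #(R ∩ range m) ∈ (range (L + 1)).image (· + L)} |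
            #(R ∩ range m) = j}) (by intro a _ b _ h; simpa using h),
      ← card_eq_sum_card_fiberwise]
    · exact card_le_card (filter_subset _ _)
    · intro R hR
      simp only [coe_filter, Set.mem_ofPred_eq] at hR
      exact hR.2
  have hsum : 2 ^ L * ∑ i ∈ range (L + 1), crossingWeight m i ≤ #(holeSteps B m) := by
    refine le_trans ?_ hlow
    rw [mul_sum]
    refine sum_le_sum fun i hi => ?_
    rw [mem_range] at hi
    exact pow_two_mul_crossingWeight_le (by omega)
  have hcover : {R ∈ holeSteps B m | #(R ∩ range m) ≤ L ∨ m ≤ #(R ∩ range m) + L} ⊆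
      (range (L + 1)).biUnion (fun i => {R ∈ holeSteps B m | #(R ∩ range m) = i} ∪
        {R ∈ holeSteps B m | #(R ∩ range m) = m - i}) := by
    intro R hR
    have := card_inter_range_le R m
    simp only [mem_filter] at hR
    simp only [mem_biUnion, mem_range, mem_union, mem_filter]
    rcases hR.2 with h | h
    · exact ⟨_, by omega, Or.inl ⟨hR.1, rfl⟩⟩
    · exact ⟨m - #(R ∩ range m), by omega, Or.inr ⟨hR.1, by omega⟩⟩
  have hle : #{R ∈ holeSteps B m | #(R ∩ range m) ≤ L ∨ m ≤ #(R ∩ range m) + L}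
      ≤ 2 * ∑ i ∈ range (L + 1), crossingWeight m i := by
    refine (card_le_card hcover).trans (card_biUnion_le.trans ?_)
    rw [mul_sum]
    refine sum_le_sum fun i hi => (card_union_le _ _).trans ?_
    rw [mem_range] at hi
    have h1 := card_crossing_le_crossingWeight B (m := m) (i := i) (by omega)
    have h2 := card_crossing_le_crossingWeight B (m := m) (i := m - i) (by omega)
    rw [crossingWeight_symm (by omega)] at h2
    omega
  calc _ ≤ 2 ^ L * (2 * ∑ i ∈ range (L + 1), crossingWeight m i) := Nat.mul_le_mul_left _ hle
    _ = 2 * (2 ^ L * ∑ i ∈ range (L + 1), crossingWeight m i) := by ring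
    _ ≤ _ := Nat.mul_le_mul_left _ hsum

/-- A bound for events of small conditional probability given the crossing of the antidiagonal
in the bulk. -/
lemma card_holeSteps_filter_le {B m L : ℕ} (hL : 6 * L + B ≤ m) {γ b : ℝ}
    (hγL : γ * (m + 4) ≤ L) (hb : 0 ≤ b) (p : Finset ℕ → Prop) [DecidablePred p]
    (hp : ∀ i ≤ m, γ * (m + 4) ≤ i → γ * (m + 4) ≤ m - i →
      (#{R ∈ holeSteps B m | #(R ∩ range m) = i ∧ p R} : ℝ)
        ≤ b * #{R ∈ holeSteps B m | #(R ∩ range m) = i}) :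
    (#{R ∈ holeSteps B m | p R} : ℝ) ≤ (b + 2 / 2 ^ L) * #(holeSteps B m) := by
  have hext := card_extreme_crossing_le hL
  set Ext : Finset ℕ → Prop := fun R => #(R ∩ range m) ≤ L ∨ m ≤ #(R ∩ range m) + L
  have hterm : ∀ i ∈ range (m + 1),
      (#{R ∈ holeSteps B m | #(R ∩ range m) = i ∧ p R} : ℝ)
        ≤ b * #{R ∈ holeSteps B m | #(R ∩ range m) = i ∧ True}
          + #{R ∈ holeSteps B m | #(R ∩ range m) = i ∧ Ext R} := by
    intro i hi
    rw [mem_range] at hi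
    -- Extreme crossings are counted in full, bulk crossings through the conditional bound.
    by_cases hb : i ≤ L ∨ m ≤ i + L
    · have : #{R ∈ holeSteps B m | #(R ∩ range m) = i ∧ p R}
          ≤ #{R ∈ holeSteps B m | #(R ∩ range m) = i ∧ Ext R} := by
        refine card_le_card (monotone_filter_right _ fun R _ h => ⟨h.1, ?_⟩)
        simp only [Ext]
        rw [h.1]; exact hb
      have h' : (#{R ∈ holeSteps B m | #(R ∩ range m) = i ∧ p R} : ℝ)
          ≤ #{R ∈ holeSteps B m | #(R ∩ range m) = i ∧ Ext R} := by exact_mod_cast this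
      have : 0 ≤ b * (#{R ∈ holeSteps B m | #(R ∩ range m) = i ∧ True} : ℝ) := by positivity
      linarith
    · push Not at hb
      have c1 : (L : ℝ) ≤ i := by exact_mod_cast hb.1.le
      have c2 : (i : ℝ) + L ≤ m := by exact_mod_cast hb.2.le
      have := hp i (by omega) (by linarith) (by linarith)
      simp only [and_true]
      have h0 : (0 : ℝ) ≤ #{R ∈ holeSteps B m | #(R ∩ range m) = i ∧ Ext R} := by positivity
      linarith
  have h1 := sum_le_sum hterm
  rw [sum_add_distrib, ← mul_sum] at h1
  have e1 := card_holeSteps_eq_sum B m p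
  have e2 := card_holeSteps_eq_sum B m (fun _ => True)
  have e3 := card_holeSteps_eq_sum B m Ext
  rw [filter_true] at e2
  have h2 : (#{R ∈ holeSteps B m | p R} : ℝ)
      ≤ b * #(holeSteps B m) + #{R ∈ holeSteps B m | Ext R} := by
    rw [e1, e2, e3]; push_cast; exact h1
  have h3 : (#{R ∈ holeSteps B m | Ext R} : ℝ) ≤ 2 / 2 ^ L * #(holeSteps B m) := by
    rw [div_mul_eq_mul_div, le_div_iff₀ (by positivity), mul_comm]
    exact_mod_cast hext
  linarith

/-- Telescoping: 1/√(n + 1) ≤ 2√(n + 1) - 2√n. -/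
lemma sum_one_div_sqrt_le (n : ℕ) : ∑ k ∈ range n, 1 / √((k : ℝ) + 1) ≤ 2 * √n := by
  induction n with
  | zero => simp
  | succ n ih =>
    rw [sum_range_succ]
    have h1 : 0 ≤ √(n : ℝ) := Real.sqrt_nonneg _
    have h2 : 0 < √((n : ℝ) + 1) := Real.sqrt_pos.2 (by positivity)
    have e1 : √(n : ℝ) ^ 2 = n := Real.sq_sqrt (by positivity)
    have e2 : √((n : ℝ) + 1) ^ 2 = n + 1 := Real.sq_sqrt (by positivity)
    have : 1 / √((n : ℝ) + 1) ≤ 2 * √((n : ℝ) + 1) - 2 * √n := by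
      rw [div_le_iff₀ h2]
      nlinarith [sq_nonneg (√((n : ℝ) + 1) - √n)]
    push_cast
    linarith

lemma sum_one_div_sqrt_reflect_le (n : ℕ) :
    ∑ k ∈ range (n + 1), 1 / √(((n - k : ℕ) : ℝ) + 1) ≤ 2 * √((n + 1 : ℕ) : ℝ) := by
  rw [← sum_range_reflect]
  refine le_trans (le_of_eq (sum_congr rfl fun k hk => ?_)) (sum_one_div_sqrt_le (n + 1))
  rw [mem_range] at hk
  rw [show n - (n + 1 - 1 - k) = k by omega]

/-- The bound for the probabilities of the positions of the path after `k` steps. -/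
noncomputable def positionBound (γ : ℝ) (m L k : ℕ) : ℝ :=
  (if k ≤ m then 16 / √γ * (1 / √(k + 1) + 1 / √((m - k : ℕ) + 1))
    else 16 / √γ * (1 / √((k - m : ℕ) + 1) + 1 / √((m + 2 - (k - m) : ℕ) + 1))) + 2 / 2 ^ L

lemma positionBound_nonneg (γ : ℝ) (m L k : ℕ) : 0 ≤ positionBound γ m L k := by
  unfold positionBound
  split_ifs <;> positivity

lemma card_position_le {B m L k x : ℕ} (hL : 6 * L + B ≤ m) {γ : ℝ} (hγ : 0 < γ)
    (hγL : γ * (m + 4) ≤ L) (hk : k ≤ 2 * m + 2) :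
    (#{R ∈ holeSteps B m | #(R ∩ range k) = x} : ℝ)
      ≤ positionBound γ m L k * #(holeSteps B m) := by
  unfold positionBound
  split_ifs with h
  · exact card_holeSteps_filter_le hL hγL (by positivity) _
      fun i him h1 h2 => card_crossing_le_of_le B h hγ h1 h2 him
  · obtain ⟨j, rfl⟩ := Nat.exists_eq_add_of_le (not_le.1 h).le
    rw [show m + j - m = j by omega]
    exact card_holeSteps_filter_le hL hγL (by positivity) _
      fun i him h1 h2 => card_crossing_le_of_ge B (by omega) hγ h1 h2 him

lemma sum_positionBound_le {γ : ℝ} (hγ : 0 < γ) {m L : ℕ} (hγL : γ * (m + 4) ≤ L) :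
    ∑ k ∈ range (2 * m + 3), positionBound γ m L k ≤ 128 / √γ * √((m + 3 : ℕ) : ℝ) + 4 / γ := by
  have hsγ : 0 < √γ := Real.sqrt_pos.2 hγ
  have hm1 : √((m + 1 : ℕ) : ℝ) ≤ √((m + 3 : ℕ) : ℝ) := Real.sqrt_le_sqrt (by push_cast; linarith)
  have hLpos : (0 : ℝ) < L := lt_of_lt_of_le (by positivity) hγL
  have h2L : (L : ℝ) ≤ 2 ^ L := by exact_mod_cast Nat.lt_two_pow_self.le
  unfold positionBound
  rw [sum_add_distrib, show 2 * m + 3 = m + 1 + (m + 2) by ring, sum_range_add]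
  have s1 : ∑ k ∈ range (m + 1), (if k ≤ m then
      16 / √γ * (1 / √((k : ℝ) + 1) + 1 / √(((m - k : ℕ) : ℝ) + 1))
      else 16 / √γ * (1 / √(((k - m : ℕ) : ℝ) + 1) + 1 / √(((m + 2 - (k - m) : ℕ) : ℝ) + 1)))
      ≤ 16 / √γ * (4 * √((m + 3 : ℕ) : ℝ)) := by
    have e : ∀ k ∈ range (m + 1), (if k ≤ m then
        16 / √γ * (1 / √((k : ℝ) + 1) + 1 / √(((m - k : ℕ) : ℝ) + 1))
        else 16 / √γ * (1 / √(((k - m : ℕ) : ℝ) + 1) + 1 / √(((m + 2 - (k - m) : ℕ) : ℝ) + 1)))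
        = 16 / √γ * (1 / √((k : ℝ) + 1) + 1 / √(((m - k : ℕ) : ℝ) + 1)) := fun k hk => by
      rw [mem_range] at hk
      rw [if_pos (by omega)]
    rw [sum_congr rfl e, ← mul_sum, sum_add_distrib]
    have := sum_one_div_sqrt_le (m + 1)
    have := sum_one_div_sqrt_reflect_le m
    gcongr
    linarith
  have s2 : ∑ j ∈ range (m + 2), (if m + 1 + j ≤ m then
      16 / √γ * (1 / √(((m + 1 + j : ℕ) : ℝ) + 1) + 1 / √(((m - (m + 1 + j) : ℕ) : ℝ) + 1))
      else 16 / √γ * (1 / √(((m + 1 + j - m : ℕ) : ℝ) + 1)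
        + 1 / √(((m + 2 - (m + 1 + j - m) : ℕ) : ℝ) + 1)))
      ≤ 16 / √γ * (4 * √((m + 3 : ℕ) : ℝ)) := by
    set f : ℕ → ℝ := fun j => 1 / √((j : ℝ) + 1) with hf
    set g : ℕ → ℝ := fun j => 1 / √(((m + 2 - j : ℕ) : ℝ) + 1) with hg
    have e : ∀ j ∈ range (m + 2), (if m + 1 + j ≤ m then
        16 / √γ * (1 / √(((m + 1 + j : ℕ) : ℝ) + 1) + 1 / √(((m - (m + 1 + j) : ℕ) : ℝ) + 1))
        else 16 / √γ * (1 / √(((m + 1 + j - m : ℕ) : ℝ) + 1)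
          + 1 / √(((m + 2 - (m + 1 + j - m) : ℕ) : ℝ) + 1)))
        = 16 / √γ * (f (j + 1) + g (j + 1)) := fun j _ => by
      rw [if_neg (by omega), show m + 1 + j - m = j + 1 by omega]
    rw [sum_congr rfl e, ← mul_sum, sum_add_distrib]
    have h1 : ∑ j ∈ range (m + 3), f j ≤ _ := sum_one_div_sqrt_le (m + 3)
    have h2 : ∑ j ∈ range (m + 3), g j ≤ _ := sum_one_div_sqrt_reflect_le (m + 2)
    rw [sum_range_succ'] at h1 h2
    have f0 : 0 ≤ f 0 := by positivity
    have g0 : 0 ≤ g 0 := by positivity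
    gcongr
    linarith
  -- The crude inequality 2^L ≥ L ≥ γ(m + 4) already makes the total contribution of extreme
  -- crossings bounded.
  have s3 : ∑ _k ∈ range (m + 1 + (m + 2)), (2 : ℝ) / 2 ^ L ≤ 4 / γ := by
    rw [sum_const, card_range, nsmul_eq_mul, mul_div_assoc', div_le_div_iff₀ (by positivity) hγ]
    push_cast
    nlinarith
  calc _ ≤ 16 / √γ * (4 * √((m + 3 : ℕ) : ℝ)) + 16 / √γ * (4 * √((m + 3 : ℕ) : ℝ)) + 4 / γ := by
        exact add_le_add (add_le_add s1 s2) s3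
    _ = _ := by ring

/-! ### Visit probabilities and the expected overlap -/

/-- The square visited after `k` steps, given the set `R` of horizontal steps. -/
def latticePoint (R : Finset ℕ) (k : ℕ) : ℕ+ × ℕ+ :=
  (Nat.succPNat #(R ∩ range k), Nat.succPNat (k - #(R ∩ range k)))

/-- The squares visited in the first `n` instants. -/
def visited (n : ℕ) (R : Finset ℕ) : Finset (ℕ+ × ℕ+) := (range n).image (latticePoint R)

/-- The time at which a square can be visited. -/
def level (a : ℕ+ × ℕ+) : ℕ := (a.1 : ℕ) + a.2 - 2

lemma level_latticePoint (R : Finset ℕ) (k : ℕ) : level (latticePoint R k) = k := by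
  have := card_inter_range_le R k
  simp only [level, latticePoint, Nat.succPNat_coe]
  omega

lemma latticePoint_injective (R : Finset ℕ) : Function.Injective (latticePoint R) :=
  Function.LeftInverse.injective (level_latticePoint R)

/-- A square can be visited only at the time given by its level, so a visit is an event about the
position at one fixed time. -/
lemma card_visited_le {B m L : ℕ} (hL : 6 * L + B ≤ m) {γ : ℝ} (hγ : 0 < γ)
    (hγL : γ * (m + 4) ≤ L) (a : ℕ+ × ℕ+) :
    (#{R ∈ holeSteps B m | a ∈ visited (2 * m + 3) R} : ℝ)
      ≤ positionBound γ m L (level a) * #(holeSteps B m) := by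
  by_cases hk : level a ≤ 2 * m + 2
  · refine le_trans ?_ (card_position_le (x := (a.1 : ℕ) - 1) hL hγ hγL hk)
    norm_cast
    refine card_le_card (monotone_filter_right _ fun R _ h => ?_)
    obtain ⟨k, -, rfl⟩ := mem_image.1 h
    rw [level_latticePoint]
    simp [latticePoint]
  · have : #{R ∈ holeSteps B m | a ∈ visited (2 * m + 3) R} = 0 := by
      rw [card_eq_zero, filter_eq_empty_iff]
      intro R _ h
      obtain ⟨k, hk', rfl⟩ := mem_image.1 h
      rw [level_latticePoint] at hk
      rw [mem_range] at hk'
      omega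
    rw [this, Nat.cast_zero]
    exact mul_nonneg (positionBound_nonneg _ _ _ _) (by positivity)

/-- The expected overlap of two independent uniformly chosen paths. -/
lemma sum_sq_visit_le {B m L : ℕ} (hL : 6 * L + B ≤ m) {γ : ℝ} (hγ : 0 < γ)
    (hγL : γ * (m + 4) ≤ L) (U : Finset (ℕ+ × ℕ+)) :
    ∑ a ∈ U, (#{R ∈ holeSteps B m | a ∈ visited (2 * m + 3) R} : ℝ) ^ 2
      ≤ (128 / √γ * √((m + 3 : ℕ) : ℝ) + 4 / γ) * (#(holeSteps B m) : ℝ) ^ 2 := by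
  set T := holeSteps B m
  set b := positionBound γ m L
  calc ∑ a ∈ U, (#{R ∈ T | a ∈ visited (2 * m + 3) R} : ℝ) ^ 2
      ≤ ∑ a ∈ U, (#{R ∈ T | a ∈ visited (2 * m + 3) R} : ℝ) * (b (level a) * #T) := by
        refine sum_le_sum fun a _ => ?_
        rw [sq]
        exact mul_le_mul_of_nonneg_left (card_visited_le hL hγ hγL a) (by positivity)
    _ = (∑ a ∈ U, ∑ R ∈ T, if a ∈ visited (2 * m + 3) R then b (level a) else 0) * #T := by
        rw [sum_mul]
        refine sum_congr rfl fun a _ => ?_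
        rw [← sum_filter, sum_const, nsmul_eq_mul]
        ring
    _ = (∑ R ∈ T, ∑ a ∈ U, if a ∈ visited (2 * m + 3) R then b (level a) else 0) * #T := by
        rw [sum_comm]
    -- One of the two visit probabilities has been replaced by a bound depending only on the level.
    -- Each path meets every level exactly once, so the other one sums to a deterministic quantity.
    _ ≤ (∑ _R ∈ T, ∑ k ∈ range (2 * m + 3), b k) * #T := by
        refine mul_le_mul_of_nonneg_right (sum_le_sum fun R _ => ?_) (by positivity)
        rw [← sum_filter]
        calc _ ≤ ∑ a ∈ visited (2 * m + 3) R, b (level a) := by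
              refine sum_le_sum_of_subset_of_nonneg (fun a ha => (mem_filter.1 ha).2)
                fun a _ _ => positionBound_nonneg _ _ _ _
          _ = ∑ k ∈ range (2 * m + 3), b k := by
              rw [visited, sum_image (latticePoint_injective R).injOn]
              simp only [level_latticePoint]
    _ = (∑ k ∈ range (2 * m + 3), b k) * (#T : ℝ) ^ 2 := by
        rw [sum_const, nsmul_eq_mul]; ring
    _ ≤ _ := by
        gcongr
        exact sum_positionBound_le hγ hγL

lemma holeSteps_nonempty {B m : ℕ} (h : B ≤ m) : (holeSteps B m).Nonempty := by
  have h0 := card_holeSteps_crossing (B := B) (m := m) (i := 0) (by omega) (by omega)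
  have : 0 < #{R ∈ holeSteps B m | #(R ∩ range m) = 0} := by
    rw [h0, crossingWeight]
    exact Nat.mul_pos (Nat.choose_pos (by omega)) (Nat.choose_pos (by omega))
  exact (card_pos.1 this).mono (filter_subset _ _)

/-- For paths which avoid a hole of linear size, the expected overlap is of the order of the
square root of their length. -/
lemma exists_overlap_bound {β : ℝ} (hβ : β ∈ Set.Ioo (0 : ℝ) 1) :
    ∃ C : ℝ, 0 < C ∧ ∀ᶠ m : ℕ in atTop, (holeSteps ⌊β * (m + 2 : ℕ)⌋₊ m).Nonempty ∧
      ∀ U : Finset (ℕ+ × ℕ+),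
        ∑ a ∈ U, (#{R ∈ holeSteps ⌊β * (m + 2 : ℕ)⌋₊ m | a ∈ visited (2 * m + 3) R} : ℝ) ^ 2
          ≤ C * √m * (#(holeSteps ⌊β * (m + 2 : ℕ)⌋₊ m) : ℝ) ^ 2 := by
  obtain ⟨hβ0, hβ1⟩ := hβ
  -- With L = ⌊2γm⌋ one has 6L + B ≤ 12γm + (1 - 16γ)(m + 2) ≤ m and γ(m + 4) ≤ 2γm - 1 < L for
  -- large m.
  set γ := (1 - β) / 16 with hγdef
  have hγ : 0 < γ := by rw [hγdef]; linarith
  refine ⟨256 / √γ + 4 / γ, by positivity, ?_⟩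
  have hlarge : ∀ᶠ m : ℕ in atTop, 2 / γ + 4 ≤ (m : ℝ) :=
    tendsto_natCast_atTop_atTop.eventually_ge_atTop _
  filter_upwards [hlarge] with m hm
  have hm' : 2 ≤ γ * (m - 4) := by
    have := mul_le_mul_of_nonneg_left hm hγ.le
    rw [mul_add, mul_div_cancel₀ _ hγ.ne'] at this
    linarith
  have hm4 : (4 : ℝ) ≤ m := by
    have : 0 < 2 / γ := by positivity
    linarith
  have hB : (⌊β * (m + 2 : ℕ)⌋₊ : ℝ) ≤ β * (m + 2 : ℕ) := Nat.floor_le (by positivity)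
  set B := ⌊β * (m + 2 : ℕ)⌋₊
  rw [Nat.cast_add, Nat.cast_ofNat] at hB
  set L := ⌊2 * γ * m⌋₊ with hLdef
  have hL1 : (L : ℝ) ≤ 2 * γ * m := Nat.floor_le (by positivity)
  have hL2 : 2 * γ * m < L + 1 := Nat.lt_floor_add_one _
  have hL : 6 * L + B ≤ m := by
    have hb : β = 1 - 16 * γ := by rw [hγdef]; ring
    have : (6 * L + B : ℝ) ≤ m := by
      have hB' : (B : ℝ) ≤ (1 - 16 * γ) * (m + 2) := by rw [← hb]; exact hB
      nlinarith
    exact_mod_cast this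
  refine ⟨holeSteps_nonempty (by omega), fun U => ?_⟩
  refine (sum_sq_visit_le hL hγ (by nlinarith) U).trans ?_
  gcongr
  have h1 : (1 : ℝ) ≤ √m := by rw [Real.one_le_sqrt]; linarith
  have h2 : √((m + 3 : ℕ) : ℝ) ≤ 2 * √m := by
    rw [Real.sqrt_le_left (by positivity), mul_pow, Real.sq_sqrt (by linarith)]
    push_cast; linarith
  have h3 : 0 < 128 / √γ := by positivity
  have h4 : 0 < 4 / γ := by positivity
  calc 128 / √γ * √((m + 3 : ℕ) : ℝ) + 4 / γ ≤ 128 / √γ * (2 * √m) + 4 / γ * √m := by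
        gcongr
        exact le_mul_of_one_le_right h4.le h1
    _ = _ := by ring

end Counting

/-! ### Moment bounds for martingales with independent innovations -/

/-- The term linear in y is kept exactly, because it has mean zero when y is a martingale increment.
The other odd power of y is absorbed into even ones by 2xy ≤ x² + y². -/
lemma add_pow_four_le (x y : ℝ) :
    (x + y) ^ 4 ≤ x ^ 4 + 4 * (x ^ 3 * y) + 8 * (x ^ 2 * y ^ 2) + 3 * y ^ 4 := by
  nlinarith [mul_nonneg (sq_nonneg y) (sq_nonneg (x - y))]

lemma add_pow_six_le (x y : ℝ) :
    (x + y) ^ 6 ≤ x ^ 6 + 6 * (x ^ 5 * y) + 25 * (x ^ 4 * y ^ 2) + 28 * (x ^ 2 * y ^ 4)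
      + 4 * y ^ 6 := by
  nlinarith [mul_nonneg (mul_nonneg (sq_nonneg x) (sq_nonneg y)) (sq_nonneg (x - y)),
    mul_nonneg (mul_nonneg (sq_nonneg y) (sq_nonneg y)) (sq_nonneg (x - y))]

section MomentStep

variable {Ω E : Type*} [MeasurableSpace Ω] [MeasurableSpace E] {P : Measure Ω}
  [IsProbabilityMeasure P] {Y : Ω → E} {ξ : Ω → ℂ} {m : E → ℝ} {g : E → ℂ}

lemma integrable_of_norm_le {F : Type*} [NormedAddCommGroup F] [MeasurableSpace F]
    [BorelSpace F] [SecondCountableTopology F] {f : Ω → F} (hf : Measurable f)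
    {C : ℝ} (h : ∀ ω, ‖f ω‖ ≤ C) : Integrable f P :=
  Integrable.of_bound hf.aestronglyMeasurable C (ae_of_all _ h)

lemma norm_integral_le_one {f : Ω → ℂ} (h : ∀ ω, ‖f ω‖ ≤ 1) : ‖∫ ω, f ω ∂P‖ ≤ 1 := by
  simpa using norm_integral_le_of_norm_le_const (μ := P) (ae_of_all _ h)

/-- Re (ξ g) = Re ξ · Re g - Im ξ · Im g, and in each product the factor from ξ is centred and
independent of the rest. -/
lemma integral_past_mul_increment_eq_zero (hY : Measurable Y) (hξ : Measurable ξ)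
    (hm : Measurable m) (hg : Measurable g) (hind : IndepFun Y ξ P) {A B C : ℝ}
    (hmA : ∀ ω, |m (Y ω)| ≤ A) (hξB : ∀ ω, ‖ξ ω‖ ≤ B) (hgC : ∀ ω, ‖g (Y ω)‖ ≤ C)
    (hmean : ∫ ω, ξ ω ∂P = 0) :
    ∫ ω, m (Y ω) * (ξ ω * g (Y ω)).re ∂P = 0 := by
  have hA : 0 ≤ A := by
    obtain ⟨ω⟩ : Nonempty Ω := P.nonempty_of_neZero
    exact (abs_nonneg _).trans (hmA ω)
  have hint : Integrable ξ P := integrable_of_norm_le hξ hξB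
  have hre : ∫ ω, (ξ ω).re ∂P = 0 := by
    have := integral_re (𝕜 := ℂ) hint
    simp only [RCLike.re_eq_complex_re] at this
    rw [this, hmean]; rfl
  have him : ∫ ω, (ξ ω).im ∂P = 0 := by
    have := integral_im (𝕜 := ℂ) hint
    simp only [RCLike.im_eq_complex_im] at this
    rw [this, hmean]; rfl
  have i1 : IndepFun (fun ω => m (Y ω) * (g (Y ω)).re) (fun ω => (ξ ω).re) P :=
    hind.comp (φ := fun y => m y * (g y).re) (ψ := Complex.re)
      (hm.mul (Complex.measurable_re.comp hg)) Complex.measurable_re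
  have i2 : IndepFun (fun ω => m (Y ω) * (g (Y ω)).im) (fun ω => (ξ ω).im) P :=
    hind.comp (φ := fun y => m y * (g y).im) (ψ := Complex.im)
      (hm.mul (Complex.measurable_im.comp hg)) Complex.measurable_im
  have e1 := i1.integral_fun_mul_eq_mul_integral (by fun_prop) (by fun_prop)
  have e2 := i2.integral_fun_mul_eq_mul_integral (by fun_prop) (by fun_prop)
  rw [hre, mul_zero] at e1
  rw [him, mul_zero] at e2
  have hb : ∀ (x : ℂ → ℝ), (∀ z, |x z| ≤ ‖z‖) → ∀ ω,
      ‖m (Y ω) * x (g (Y ω)) * x (ξ ω)‖ ≤ A * C * B := by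
    intro x hx ω
    rw [norm_mul, norm_mul, Real.norm_eq_abs, Real.norm_eq_abs, Real.norm_eq_abs]
    have h1 := (hx _).trans (hgC ω)
    have h2 := (hx _).trans (hξB ω)
    have h3 := hmA ω
    have h4 : 0 ≤ C := (abs_nonneg _).trans h1
    gcongr
  calc ∫ ω, m (Y ω) * (ξ ω * g (Y ω)).re ∂P
      = ∫ ω, (m (Y ω) * (g (Y ω)).re * (ξ ω).re - m (Y ω) * (g (Y ω)).im * (ξ ω).im) ∂P := by
        congr 1; ext ω; rw [Complex.mul_re]; ring
    _ = 0 := by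
        rw [integral_sub, e1, e2, sub_zero]
        · exact integrable_of_norm_le (by fun_prop) (hb _ Complex.abs_re_le_norm)
        · exact integrable_of_norm_le (by fun_prop) (hb _ Complex.abs_im_le_norm)

/-- One step of the moment bounds for martingales with increments `Re (ξ G)`, where `G` is a
function of the past and `ξ` is centred and independent of the past. -/
lemma moment_step (hY : Measurable Y) (hξ : Measurable ξ)
    (hm : Measurable m) (hg : Measurable g) (hind : IndepFun Y ξ P) {A B p V δ : ℝ}
    (hmA : ∀ ω, |m (Y ω)| ≤ A) (hξB : ∀ ω, ‖ξ ω‖ ≤ B) (hgp : ∀ ω, ‖g (Y ω)‖ ≤ p)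
    (hmean : ∫ ω, ξ ω ∂P = 0) (hV0 : 0 ≤ V) (hδ : 0 ≤ δ)
    (hξ2 : ∫ ω, ‖ξ ω‖ ^ 2 ∂P ≤ δ) (hξ4 : ∫ ω, ‖ξ ω‖ ^ 4 ∂P ≤ δ ^ 2)
    (hξ6 : ∫ ω, ‖ξ ω‖ ^ 6 ∂P ≤ δ ^ 3)
    (hM2 : ∫ ω, m (Y ω) ^ 2 ∂P ≤ V) (hM4 : ∫ ω, m (Y ω) ^ 4 ∂P ≤ V ^ 2)
    (hM6 : ∫ ω, m (Y ω) ^ 6 ∂P ≤ V ^ 3) :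
    ∫ ω, (m (Y ω) + (ξ ω * g (Y ω)).re) ^ 2 ∂P ≤ V + 9 * δ * p ^ 2 ∧
    ∫ ω, (m (Y ω) + (ξ ω * g (Y ω)).re) ^ 4 ∂P ≤ (V + 9 * δ * p ^ 2) ^ 2 ∧
    ∫ ω, (m (Y ω) + (ξ ω * g (Y ω)).re) ^ 6 ∂P ≤ (V + 9 * δ * p ^ 2) ^ 3 := by
  obtain ⟨ω₀⟩ : Nonempty Ω := P.nonempty_of_neZero
  have hA : 0 ≤ A := (abs_nonneg _).trans (hmA ω₀)
  have hB : 0 ≤ B := (norm_nonneg _).trans (hξB ω₀)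
  have hp : 0 ≤ p := (norm_nonneg _).trans (hgp ω₀)
  set M : Ω → ℝ := fun ω => m (Y ω) with hMdef
  set D : Ω → ℝ := fun ω => (ξ ω * g (Y ω)).re with hDdef
  have hMm : Measurable M := hm.comp hY
  have hDm : Measurable D := Complex.measurable_re.comp (hξ.mul (hg.comp hY))
  have hDb : ∀ ω, |D ω| ≤ p * ‖ξ ω‖ := fun ω => by
    refine (Complex.abs_re_le_norm _).trans ?_
    rw [norm_mul, mul_comm]
    exact mul_le_mul_of_nonneg_right (hgp _) (norm_nonneg _)
  have hDB : ∀ ω, |D ω| ≤ p * B := fun ω => (hDb ω).trans (by gcongr; exact hξB ω)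
  have hD2 : ∀ ω, D ω ^ 2 ≤ p ^ 2 * ‖ξ ω‖ ^ 2 := fun ω => by
    rw [← mul_pow, ← sq_abs]; gcongr; exact hDb ω
  have hD4 : ∀ ω, D ω ^ 4 ≤ p ^ 4 * ‖ξ ω‖ ^ 4 := fun ω => by
    rw [← mul_pow, ← Even.pow_abs (by decide)]; gcongr; exact hDb ω
  have hD6 : ∀ ω, D ω ^ 6 ≤ p ^ 6 * ‖ξ ω‖ ^ 6 := fun ω => by
    rw [← mul_pow, ← Even.pow_abs (by decide)]; gcongr; exact hDb ω
  have hodd : ∀ n, ∫ ω, M ω ^ n * D ω ∂P = 0 := fun n =>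
    integral_past_mul_increment_eq_zero (m := fun y => m y ^ n) hY hξ (hm.pow_const n) hg hind
      (A := A ^ n) (fun y => by rw [abs_pow]; gcongr; exact hmA y) hξB hgp hmean
  have hoddI : ∀ n, Integrable (fun ω => M ω ^ n * D ω) P := fun n =>
    integrable_of_norm_le (C := A ^ n * (p * B)) (by fun_prop) fun ω => by
      rw [norm_mul, norm_pow, Real.norm_eq_abs, Real.norm_eq_abs]
      gcongr
      · exact hmA _
      · exact hDB ω
  have hmixI : ∀ i j, Integrable (fun ω => M ω ^ i * ‖ξ ω‖ ^ j) P := fun i j =>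
    integrable_of_norm_le (C := A ^ i * B ^ j) (by fun_prop) fun ω => by
      rw [norm_mul, norm_pow, norm_pow, Real.norm_eq_abs, norm_norm]
      gcongr
      · exact hmA _
      · exact hξB ω
  have hmix : ∀ i j, ∫ ω, M ω ^ i * ‖ξ ω‖ ^ j ∂P
      = (∫ ω, M ω ^ i ∂P) * ∫ ω, ‖ξ ω‖ ^ j ∂P := fun i j => by
    have hi : IndepFun (fun ω => M ω ^ i) (fun ω => ‖ξ ω‖ ^ j) P :=
      hind.comp (φ := fun y => m y ^ i) (ψ := fun z => ‖z‖ ^ j)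
        (hm.pow_const i) (measurable_norm.pow_const j)
    exact hi.integral_fun_mul_eq_mul_integral (by fun_prop) (by fun_prop)
  have hMI : ∀ i, Integrable (fun ω => M ω ^ i) P := fun i => by simpa using hmixI i 0
  have hξI : ∀ i, Integrable (fun ω => ‖ξ ω‖ ^ i) P := fun i => by simpa using hmixI 0 i
  have hSI : ∀ i, Integrable (fun ω => (M ω + D ω) ^ i) P := fun i =>
    integrable_of_norm_le (C := (A + p * B) ^ i) (by fun_prop) fun ω => by
      rw [norm_pow, Real.norm_eq_abs]
      gcongr
      exact (abs_add_le _ _).trans (add_le_add (hmA _) (hDB ω))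
  have nξ2 : 0 ≤ ∫ ω, ‖ξ ω‖ ^ 2 ∂P := integral_nonneg fun _ => by positivity
  have nξ4 : 0 ≤ ∫ ω, ‖ξ ω‖ ^ 4 ∂P := integral_nonneg fun _ => by positivity
  have nM2 : 0 ≤ ∫ ω, M ω ^ 2 ∂P := integral_nonneg fun _ => by positivity
  have nM4 : 0 ≤ ∫ ω, M ω ^ 4 ∂P := integral_nonneg fun _ => by positivity
  refine ⟨?_, ?_, ?_⟩
  · have h1 : Integrable (fun ω => M ω ^ 2 + 2 * (M ω ^ 1 * D ω)) P :=
      (hMI 2).add ((hoddI 1).const_mul 2)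
    calc ∫ ω, (M ω + D ω) ^ 2 ∂P
        ≤ ∫ ω, (M ω ^ 2 + 2 * (M ω ^ 1 * D ω) + p ^ 2 * ‖ξ ω‖ ^ 2) ∂P := by
          refine integral_mono (hSI 2) (h1.add ((hξI 2).const_mul _)) fun ω => ?_
          have := hD2 ω
          dsimp only
          linarith
      _ = ∫ ω, M ω ^ 2 ∂P + p ^ 2 * ∫ ω, ‖ξ ω‖ ^ 2 ∂P := by
          rw [integral_add h1 ((hξI 2).const_mul _),
            integral_add (hMI 2) ((hoddI 1).const_mul 2), integral_const_mul, integral_const_mul,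
            hodd]
          ring
      _ ≤ V + p ^ 2 * δ := by gcongr
      _ ≤ V + 9 * δ * p ^ 2 := by nlinarith [mul_nonneg hδ (sq_nonneg p)]
  · have h1 : Integrable (fun ω => M ω ^ 4 + 4 * (M ω ^ 3 * D ω)) P :=
      (hMI 4).add ((hoddI 3).const_mul 4)
    have h2 : Integrable (fun ω => M ω ^ 4 + 4 * (M ω ^ 3 * D ω)
        + 8 * p ^ 2 * (M ω ^ 2 * ‖ξ ω‖ ^ 2)) P := h1.add ((hmixI 2 2).const_mul _)
    calc ∫ ω, (M ω + D ω) ^ 4 ∂P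
        ≤ ∫ ω, (M ω ^ 4 + 4 * (M ω ^ 3 * D ω) + 8 * p ^ 2 * (M ω ^ 2 * ‖ξ ω‖ ^ 2)
            + 3 * p ^ 4 * ‖ξ ω‖ ^ 4) ∂P := by
          refine integral_mono (hSI 4) (h2.add ((hξI 4).const_mul _)) fun ω => ?_
          have a2 := mul_le_mul_of_nonneg_left (hD2 ω) (sq_nonneg (M ω))
          have a4 := hD4 ω
          have := add_pow_four_le (M ω) (D ω)
          dsimp only
          linarith
      _ = ∫ ω, M ω ^ 4 ∂P + 8 * p ^ 2 * ((∫ ω, M ω ^ 2 ∂P) * ∫ ω, ‖ξ ω‖ ^ 2 ∂P)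
            + 3 * p ^ 4 * ∫ ω, ‖ξ ω‖ ^ 4 ∂P := by
          rw [integral_add h2 ((hξI 4).const_mul _), integral_add h1 ((hmixI 2 2).const_mul _),
            integral_add (hMI 4) ((hoddI 3).const_mul 4), integral_const_mul, integral_const_mul,
            integral_const_mul, hodd, hmix]
          ring
      _ ≤ V ^ 2 + 8 * p ^ 2 * (V * δ) + 3 * p ^ 4 * δ ^ 2 := by gcongr
      _ ≤ (V + 9 * δ * p ^ 2) ^ 2 := by
          nlinarith [mul_nonneg (mul_nonneg hV0 hδ) (sq_nonneg p), sq_nonneg (δ * p ^ 2)]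
  · have h1 : Integrable (fun ω => M ω ^ 6 + 6 * (M ω ^ 5 * D ω)) P :=
      (hMI 6).add ((hoddI 5).const_mul 6)
    have h2 : Integrable (fun ω => M ω ^ 6 + 6 * (M ω ^ 5 * D ω)
        + 25 * p ^ 2 * (M ω ^ 4 * ‖ξ ω‖ ^ 2)) P := h1.add ((hmixI 4 2).const_mul _)
    have h3 : Integrable (fun ω => M ω ^ 6 + 6 * (M ω ^ 5 * D ω)
        + 25 * p ^ 2 * (M ω ^ 4 * ‖ξ ω‖ ^ 2) + 28 * p ^ 4 * (M ω ^ 2 * ‖ξ ω‖ ^ 4)) P :=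
      h2.add ((hmixI 2 4).const_mul _)
    calc ∫ ω, (M ω + D ω) ^ 6 ∂P
        ≤ ∫ ω, (M ω ^ 6 + 6 * (M ω ^ 5 * D ω) + 25 * p ^ 2 * (M ω ^ 4 * ‖ξ ω‖ ^ 2)
            + 28 * p ^ 4 * (M ω ^ 2 * ‖ξ ω‖ ^ 4) + 4 * p ^ 6 * ‖ξ ω‖ ^ 6) ∂P := by
          refine integral_mono (hSI 6) (h3.add ((hξI 6).const_mul _)) fun ω => ?_
          have a2 := mul_le_mul_of_nonneg_left (hD2 ω) (by positivity : 0 ≤ M ω ^ 4)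
          have a4 := mul_le_mul_of_nonneg_left (hD4 ω) (sq_nonneg (M ω))
          have a6 := hD6 ω
          have := add_pow_six_le (M ω) (D ω)
          dsimp only
          linarith
      _ = ∫ ω, M ω ^ 6 ∂P + 25 * p ^ 2 * ((∫ ω, M ω ^ 4 ∂P) * ∫ ω, ‖ξ ω‖ ^ 2 ∂P)
            + 28 * p ^ 4 * ((∫ ω, M ω ^ 2 ∂P) * ∫ ω, ‖ξ ω‖ ^ 4 ∂P)
            + 4 * p ^ 6 * ∫ ω, ‖ξ ω‖ ^ 6 ∂P := by
          rw [integral_add h3 ((hξI 6).const_mul _), integral_add h2 ((hmixI 2 4).const_mul _),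
            integral_add h1 ((hmixI 4 2).const_mul _),
            integral_add (hMI 6) ((hoddI 5).const_mul 6), integral_const_mul, integral_const_mul,
            integral_const_mul, integral_const_mul, hodd, hmix, hmix]
          ring
      _ ≤ V ^ 3 + 25 * p ^ 2 * (V ^ 2 * δ) + 28 * p ^ 4 * (V * δ ^ 2)
            + 4 * p ^ 6 * δ ^ 3 := by gcongr
      -- The constant 9 is dictated by the coefficient 25 ≤ 3 · 9 of V²δp²; all other comparisons
      -- have room to spare.
      _ ≤ (V + 9 * δ * p ^ 2) ^ 3 := by
          have e1 : 0 ≤ p ^ 2 * (V ^ 2 * δ) := by positivity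
          have e2 : 0 ≤ p ^ 4 * (V * δ ^ 2) := by positivity
          have e3 : 0 ≤ p ^ 6 * δ ^ 3 := by positivity
          nlinarith

end MomentStep

/-! ### The Doob martingale of an average of products -/

section Average

variable {Ω ι τ : Type*} [DecidableEq ι]

/-- The weighted average over `σ ∈ T` of the products of the variables `X a`, `a ∈ A σ`, in which
those with index outside `s` are replaced by constants `c a`. -/
def partialAverage (X : ι → Ω → ℂ) (c : ι → ℂ) (T : Finset τ) (ν : τ → ℂ) (A : τ → Finset ι)
    (s : Finset ι) (ω : Ω) : ℂ :=
  ∑ σ ∈ T, ν σ * ∏ a ∈ A σ, if a ∈ s then X a ω else c a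

variable {X : ι → Ω → ℂ} {c : ι → ℂ} {T : Finset τ} {ν : τ → ℂ} {A : τ → Finset ι}

lemma norm_prod_ite_le_one {x : ι → ℂ} (hx : ∀ a, ‖x a‖ ≤ 1) (hc : ∀ a, ‖c a‖ ≤ 1)
    (s t : Finset ι) : ‖∏ a ∈ t, if a ∈ s then x a else c a‖ ≤ 1 := by
  rw [norm_prod]
  refine Finset.prod_le_one (fun _ _ => norm_nonneg _) fun a _ => ?_
  split_ifs
  · exact hx a
  · exact hc a

/-- Only products containing the factor with index a change when it is revealed. When c is the mean
of X this is the martingale increment: an innovation times a quantity depending on the variables in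
s alone. -/
lemma partialAverage_insert_sub {s : Finset ι} {a : ι} (ha : a ∉ s) (ω : Ω) :
    partialAverage X c T ν A (insert a s) ω - partialAverage X c T ν A s ω
      = (X a ω - c a)
        * partialAverage X c (T.filter fun σ => a ∈ A σ) ν (fun σ => (A σ).erase a) s ω := by
  unfold partialAverage
  rw [← Finset.sum_sub_distrib, Finset.mul_sum, Finset.sum_filter]
  refine Finset.sum_congr rfl fun σ _ => ?_
  split_ifs with h
  · rw [← Finset.mul_prod_erase _ _ h, ← Finset.mul_prod_erase _ _ h]
    have : ∏ b ∈ (A σ).erase a, (if b ∈ insert a s then X b ω else c b)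
        = ∏ b ∈ (A σ).erase a, (if b ∈ s then X b ω else c b) := by
      refine Finset.prod_congr rfl fun b hb => ?_
      have := Finset.ne_of_mem_erase hb
      simp [Finset.mem_insert, this]
    rw [this]
    simp only [Finset.mem_insert_self, if_true, ha, if_false]
    ring
  · rw [sub_eq_zero]
    congr 1
    refine Finset.prod_congr rfl fun b hb => ?_
    have : b ≠ a := fun e => h (e ▸ hb)
    simp [Finset.mem_insert, this]

/-- The function of the variables in `s` which gives the partial average. -/
def partialAverageFun (c : ι → ℂ) (T : Finset τ) (ν : τ → ℂ) (A : τ → Finset ι)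
    (s : Finset ι) (x : s → ℂ) : ℂ :=
  ∑ σ ∈ T, ν σ * ∏ a ∈ A σ, if h : a ∈ s then x ⟨a, h⟩ else c a

lemma partialAverageFun_apply (s : Finset ι) (ω : Ω) :
    partialAverageFun c T ν A s (fun i => X i ω) = partialAverage X c T ν A s ω := by
  unfold partialAverageFun partialAverage
  simp

lemma measurable_partialAverageFun (s : Finset ι) :
    Measurable (partialAverageFun c T ν A s) := by
  unfold partialAverageFun
  refine Finset.measurable_sum _ fun σ _ => Measurable.const_mul ?_ _
  refine Finset.measurable_prod _ fun a _ => ?_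
  split_ifs
  · exact measurable_pi_apply _
  · exact measurable_const

lemma norm_partialAverage_le (hX : ∀ a ω, ‖X a ω‖ ≤ 1) (hc : ∀ a, ‖c a‖ ≤ 1) (s : Finset ι)
    (ω : Ω) : ‖partialAverage X c T ν A s ω‖ ≤ ∑ σ ∈ T, ‖ν σ‖ := by
  refine (norm_sum_le _ _).trans (Finset.sum_le_sum fun σ _ => ?_)
  rw [norm_mul]
  exact mul_le_of_le_one_right (norm_nonneg _)
    (norm_prod_ite_le_one (x := fun a => X a ω) (fun a => hX a ω) hc _ _)

lemma partialAverage_const_mul (z : ℂ) (s : Finset ι) (ω : Ω) :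
    partialAverage X c T (fun σ => z * ν σ) A s ω = z * partialAverage X c T ν A s ω := by
  simp only [partialAverage, Finset.mul_sum, mul_assoc]

variable [MeasurableSpace Ω] {P : Measure Ω} [IsProbabilityMeasure P]

/-- Induction on the revealed set. The factor multiplying each innovation is at most the total
weight of the index sets through a, so every step adds 9δ times the square of that weight to V. -/
lemma partialAverage_re_moments (hX : ∀ a, Measurable (X a)) (hind : iIndepFun X P)
    (hX1 : ∀ a ω, ‖X a ω‖ ≤ 1) (hc : ∀ a, ∫ ω, X a ω ∂P = c a) {δ : ℝ} (hδ : 0 ≤ δ)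
    (h2 : ∀ a, ∫ ω, ‖X a ω - c a‖ ^ 2 ∂P ≤ δ) (h4 : ∀ a, ∫ ω, ‖X a ω - c a‖ ^ 4 ∂P ≤ δ ^ 2)
    (h6 : ∀ a, ∫ ω, ‖X a ω - c a‖ ^ 6 ∂P ≤ δ ^ 3) (s : Finset ι) :
    let M : Ω → ℝ := fun ω =>
      (partialAverage X c T ν A s ω - partialAverage X c T ν A ∅ ω).re
    let V : ℝ := 9 * δ * ∑ a ∈ s, (∑ σ ∈ T with a ∈ A σ, ‖ν σ‖) ^ 2
    ∫ ω, M ω ^ 2 ∂P ≤ V ∧ ∫ ω, M ω ^ 4 ∂P ≤ V ^ 2 ∧ ∫ ω, M ω ^ 6 ∂P ≤ V ^ 3 := by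
  obtain ⟨ω₀⟩ : Nonempty Ω := P.nonempty_of_neZero
  have hc1 : ∀ a, ‖c a‖ ≤ 1 := fun a => by
    rw [← hc a]
    exact norm_integral_le_one (hX1 a)
  have hempty : ∀ ω, partialAverage X c T ν A ∅ ω = partialAverage X c T ν A ∅ ω₀ := fun ω => by
    simp [partialAverage]
  dsimp only
  induction s using Finset.induction_on with
  | empty => simp
  | insert a s ha ih =>
    obtain ⟨i2, i4, i6⟩ := ih
    set Y : Ω → (s → ℂ) := fun ω i => X i ω with hYdef
    have hY : Measurable Y := measurable_pi_lambda _ fun i => hX i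
    have hindY : IndepFun Y (fun ω => X a ω - c a) P := by
      have h := hind.indepFun_finset s {a} (by simpa using ha) hX
      have hm : Measurable fun x : ({a} : Finset ι) → ℂ => x ⟨a, by simp⟩ - c a :=
        Measurable.sub (measurable_pi_apply _) measurable_const
      exact h.comp (φ := id) measurable_id hm
    have hmean : ∫ ω, (X a ω - c a) ∂P = 0 := by
      rw [integral_sub (integrable_of_norm_le (hX a) (hX1 a)) (integrable_const _), hc a]
      simp
    set C₀ := partialAverage X c T ν A ∅ ω₀ with hC₀
    set m : (s → ℂ) → ℝ := fun x => (partialAverageFun c T ν A s x - C₀).re with hmdef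
    set g : (s → ℂ) → ℂ := partialAverageFun c (T.filter fun σ => a ∈ A σ) ν
      (fun σ => (A σ).erase a) s with hgdef
    have hmm : Measurable m :=
      Complex.measurable_re.comp ((measurable_partialAverageFun s).sub_const _)
    have hmY : ∀ ω, m (Y ω) = (partialAverage X c T ν A s ω - C₀).re := fun ω => by
      rw [hmdef, hYdef, ← partialAverageFun_apply]
    have hgY : ∀ ω, g (Y ω) = partialAverage X c (T.filter fun σ => a ∈ A σ) ν
        (fun σ => (A σ).erase a) s ω := fun ω => partialAverageFun_apply s ω
    have hsum : ∀ ω, (partialAverage X c T ν A (insert a s) ω - C₀).re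
        = m (Y ω) + ((X a ω - c a) * g (Y ω)).re := fun ω => by
      rw [hmY, hgY, ← partialAverage_insert_sub ha, ← Complex.add_re]
      congr 1
      ring
    have hstep := moment_step hY ((hX a).sub_const (c a)) hmm
      (measurable_partialAverageFun (c := c) (ν := ν) (T := T.filter fun σ => a ∈ A σ)
        (A := fun σ => (A σ).erase a) s)
      hindY (A := ∑ σ ∈ T, ‖ν σ‖ + ∑ σ ∈ T, ‖ν σ‖) (B := 2)
      (p := ∑ σ ∈ T with a ∈ A σ, ‖ν σ‖)
      (fun ω => by
        rw [hmY]
        refine (Complex.abs_re_le_norm _).trans ((norm_sub_le _ _).trans (add_le_add ?_ ?_))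
        · exact norm_partialAverage_le hX1 hc1 _ _
        · exact norm_partialAverage_le hX1 hc1 _ _)
      (fun ω => by linarith [norm_sub_le (X a ω) (c a), hX1 a ω, hc1 a])
      (fun ω => by
        rw [partialAverageFun_apply]
        exact norm_partialAverage_le hX1 hc1 _ _)
      hmean (V := 9 * δ * ∑ a ∈ s, (∑ σ ∈ T with a ∈ A σ, ‖ν σ‖) ^ 2) (by positivity) hδ
      (h2 a) (h4 a) (h6 a)
      (by simpa only [hmY, hempty] using i2) (by simpa only [hmY, hempty] using i4)
      (by simpa only [hmY, hempty] using i6)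
    rw [Finset.sum_insert ha, mul_add, add_comm (9 * δ * _)]
    simp only [hempty, hsum]
    exact hstep

/-- Sixth moment bound for a weighted average of products of independent bounded variables. -/
lemma partialAverage_sixth_moment (hX : ∀ a, Measurable (X a)) (hind : iIndepFun X P)
    (hX1 : ∀ a ω, ‖X a ω‖ ≤ 1) (hc : ∀ a, ∫ ω, X a ω ∂P = c a) {δ : ℝ} (hδ : 0 ≤ δ)
    (h2 : ∀ a, ∫ ω, ‖X a ω - c a‖ ^ 2 ∂P ≤ δ) (h4 : ∀ a, ∫ ω, ‖X a ω - c a‖ ^ 4 ∂P ≤ δ ^ 2)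
    (h6 : ∀ a, ∫ ω, ‖X a ω - c a‖ ^ 6 ∂P ≤ δ ^ 3) (s : Finset ι) :
    ∫ ω, ‖partialAverage X c T ν A s ω - partialAverage X c T ν A ∅ ω‖ ^ 6 ∂P
      ≤ 8 * (9 * δ * ∑ a ∈ s, (∑ σ ∈ T with a ∈ A σ, ‖ν σ‖) ^ 2) ^ 3 := by
  have hc1 : ∀ a, ‖c a‖ ≤ 1 := fun a => by
    rw [← hc a]
    exact norm_integral_le_one (hX1 a)
  set D : Ω → ℂ := fun ω => partialAverage X c T ν A s ω - partialAverage X c T ν A ∅ ω with hD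
  have hDm : Measurable D := by
    rw [hD]
    unfold partialAverage
    refine Measurable.sub ?_ ?_ <;>
    · refine Finset.measurable_sum _ fun σ _ => Measurable.const_mul ?_ _
      refine Finset.measurable_prod _ fun a _ => ?_
      split_ifs
      · exact hX a
      · exact measurable_const
  have hDb : ∀ ω, ‖D ω‖ ≤ ∑ σ ∈ T, ‖ν σ‖ + ∑ σ ∈ T, ‖ν σ‖ := fun ω =>
    (norm_sub_le _ _).trans (add_le_add (norm_partialAverage_le hX1 hc1 _ _)
      (norm_partialAverage_le hX1 hc1 _ _))
  have r1 := (partialAverage_re_moments (T := T) (ν := ν) (A := A) hX hind hX1 hc hδ h2 h4 h6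
    s).2.2
  -- Rotating the weights by -i turns the imaginary part into a real part. The final 8 is 4 + 4 from
  -- (x + y)³ ≤ 4(x³ + y³) with x, y the squared parts.
  have r2 := (partialAverage_re_moments (T := T) (ν := fun σ => -Complex.I * ν σ) (A := A) hX hind
    hX1 hc hδ h2 h4 h6 s).2.2
  simp only [partialAverage_const_mul, norm_mul, norm_neg, Complex.norm_I, one_mul, ← mul_sub]
    at r2
  change ∫ ω, (D ω).re ^ 6 ∂P ≤ _ at r1
  have him : ∀ z : ℂ, (-Complex.I * z).re = z.im := fun z => by simp
  simp only [him] at r2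
  change ∫ ω, (D ω).im ^ 6 ∂P ≤ _ at r2
  have hI : ∀ x : ℂ → ℝ, Measurable x → (∀ z, |x z| ≤ ‖z‖) →
      Integrable (fun ω => x (D ω) ^ 6) P := fun x hx hxb =>
    integrable_of_norm_le (C := (∑ σ ∈ T, ‖ν σ‖ + ∑ σ ∈ T, ‖ν σ‖) ^ 6) (by fun_prop) fun ω => by
      rw [norm_pow, Real.norm_eq_abs]
      gcongr
      exact (hxb _).trans (hDb ω)
  have hIre := hI _ Complex.measurable_re Complex.abs_re_le_norm
  have hIim := hI _ Complex.measurable_im Complex.abs_im_le_norm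
  calc ∫ ω, ‖D ω‖ ^ 6 ∂P ≤ ∫ ω, (4 * (D ω).re ^ 6 + 4 * (D ω).im ^ 6) ∂P := by
        refine integral_mono (hI _ measurable_norm (fun z => by simp))
          ((hIre.const_mul 4).add (hIim.const_mul 4)) fun ω => ?_
        dsimp only
        have : ‖D ω‖ ^ 6 = ((D ω).re ^ 2 + (D ω).im ^ 2) ^ 3 := by
          have := Complex.sq_norm_sub_sq_re (D ω)
          rw [← this]; ring
        rw [this]
        set x := (D ω).re ^ 2
        set y := (D ω).im ^ 2
        have hx : 0 ≤ x := sq_nonneg _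
        have hy : 0 ≤ y := sq_nonneg _
        have e1 : (D ω).re ^ 6 = x ^ 3 := by simp only [x]; ring
        have e2 : (D ω).im ^ 6 = y ^ 3 := by simp only [y]; ring
        rw [e1, e2]
        nlinarith [mul_nonneg (add_nonneg hx hy) (sq_nonneg (x - y))]
    _ = 4 * ∫ ω, (D ω).re ^ 6 ∂P + 4 * ∫ ω, (D ω).im ^ 6 ∂P := by
        rw [integral_add (hIre.const_mul 4) (hIim.const_mul 4), integral_const_mul,
          integral_const_mul]
    _ ≤ _ := by linarith

end Average

/-! ### Characteristic functions: equicontinuity and Taylor expansion -/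

lemma norm_exp_mul_I_sub_sq (x y : ℝ) :
    ‖Complex.exp (x * Complex.I) - Complex.exp (y * Complex.I)‖ ^ 2
      = 2 - 2 * Real.cos (x - y) := by
  have h := Complex.sq_norm_sub_sq_re (Complex.exp (x * Complex.I) - Complex.exp (y * Complex.I))
  simp only [Complex.sub_re, Complex.sub_im, Complex.exp_ofReal_mul_I_re,
    Complex.exp_ofReal_mul_I_im] at h
  rw [Real.cos_sub]
  nlinarith [Real.sin_sq_add_cos_sq x, Real.sin_sq_add_cos_sq y]

/-- If N is the distance of the two exponentials, then N² = 2 - 2 cos((s - t)x) and N ≤ ε + N²/(4ε);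
integrate. The modulus of continuity everywhere is thus controlled by the behaviour at s - t alone.
-/
lemma norm_charFun_sub_le (μ : Measure ℝ) [IsProbabilityMeasure μ] (s t : ℝ) {ε : ℝ}
    (hε : 0 < ε) :
    ‖charFun μ s - charFun μ t‖ ≤ ε + (1 - (charFun μ (s - t)).re) / (2 * ε) := by
  have hI : ∀ r : ℝ, Integrable (fun x : ℝ => Complex.exp (r * x * Complex.I)) μ := fun r =>
    integrable_of_norm_le (C := 1) (by fun_prop) fun x => by
      rw [← Complex.ofReal_mul, Complex.norm_exp_ofReal_mul_I]
  have hcos : (charFun μ (s - t)).re = ∫ x, Real.cos ((s - t) * x) ∂μ := by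
    rw [charFun_apply_real]
    have := integral_re (𝕜 := ℂ) (hI (s - t))
    simp only [RCLike.re_eq_complex_re] at this
    rw [← this]
    congr 1
    ext x
    rw [← Complex.ofReal_mul, Complex.exp_ofReal_mul_I_re]
  have hcosI : Integrable (fun x : ℝ => Real.cos ((s - t) * x)) μ :=
    integrable_of_norm_le (C := 1) (by fun_prop) fun x => Real.abs_cos_le_one _
  rw [charFun_apply_real, charFun_apply_real, ← integral_sub (hI s) (hI t), hcos]
  calc ‖∫ x : ℝ, (Complex.exp (s * x * Complex.I) - Complex.exp (t * x * Complex.I)) ∂μ‖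
      ≤ ∫ x : ℝ, ‖Complex.exp (s * x * Complex.I) - Complex.exp (t * x * Complex.I)‖ ∂μ :=
        norm_integral_le_integral_norm _
    _ ≤ ∫ x : ℝ, (ε + (1 - Real.cos ((s - t) * x)) / (2 * ε)) ∂μ := by
        refine integral_mono ((hI s).sub (hI t)).norm
          ((integrable_const _).add (((integrable_const _).sub hcosI).div_const _)) fun x => ?_
        have h := norm_exp_mul_I_sub_sq (s * x) (t * x)
        push_cast at h
        dsimp only
        set N := ‖Complex.exp (s * x * Complex.I) - Complex.exp (t * x * Complex.I)‖
        rw [show (s - t) * x = s * x - t * x by ring]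
        have e : (1 - Real.cos (s * x - t * x)) / (2 * ε) = N ^ 2 / (4 * ε) := by
          rw [h]; field_simp; ring
        rw [e, ← sub_le_iff_le_add', le_div_iff₀ (by positivity)]
        nlinarith [sq_nonneg (N - 2 * ε)]
    _ = ε + (1 - ∫ x, Real.cos ((s - t) * x) ∂μ) / (2 * ε) := by
        have i1 : Integrable (fun x : ℝ => 1 - Real.cos ((s - t) * x)) μ :=
          (integrable_const _).sub hcosI
        rw [integral_add (integrable_const _) (i1.div_const _),
          integral_div, integral_sub (integrable_const _) hcosI]
        simp

/-- Almost everywhere convergence of characteristic functions to a characteristic function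
is convergence everywhere. -/
lemma tendsto_charFun_of_ae {μ : ℕ → Measure ℝ} [∀ n, IsProbabilityMeasure (μ n)]
    {μ₀ : Measure ℝ} [IsProbabilityMeasure μ₀]
    (h : ∀ᵐ t, Tendsto (fun n => charFun (μ n) t) atTop (𝓝 (charFun μ₀ t))) (t : ℝ) :
    Tendsto (fun n => charFun (μ n) t) atTop (𝓝 (charFun μ₀ t)) := by
  rw [Metric.tendsto_nhds]
  intro η hη
  obtain ⟨ε, hε, hεη⟩ : ∃ ε, 0 < ε ∧ 5 * ε = η := ⟨η / 5, by positivity, by ring⟩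
  have hcont : Continuous (charFun μ₀) := by fun_prop
  have h0 : Tendsto (fun r => 1 - (charFun μ₀ r).re) (𝓝 0) (𝓝 0) := by
    have : Continuous fun r => 1 - (charFun μ₀ r).re :=
      continuous_const.sub (Complex.continuous_re.comp hcont)
    simpa using this.tendsto 0
  have hsmall : ∀ᶠ r in 𝓝 (0 : ℝ), 1 - (charFun μ₀ r).re < ε ^ 2 :=
    h0.eventually_lt_const (by positivity)
  obtain ⟨ρ, hρ, hball⟩ := Metric.eventually_nhds_iff_ball.1 hsmall
  have hae : ∀ᵐ r : ℝ, Tendsto (fun n => charFun (μ n) (t - r)) atTop (𝓝 (charFun μ₀ (t - r))) :=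
    (volume.measurePreserving_sub_left t).quasiMeasurePreserving.ae h
  -- A ball has positive measure, so it contains a small r with convergence both at r and at t - r.
  -- Convergence at r makes 1 - Re of the characteristic functions small there, which bounds their
  -- change from t - r to t uniformly in large n.
  obtain ⟨r, hr, hr1, hr2⟩ : ∃ r ∈ Metric.ball (0 : ℝ) ρ,
      Tendsto (fun n => charFun (μ n) r) atTop (𝓝 (charFun μ₀ r)) ∧
      Tendsto (fun n => charFun (μ n) (t - r)) atTop (𝓝 (charFun μ₀ (t - r))) := by
    by_contra hcon
    push Not at hcon
    have hsub : Metric.ball (0 : ℝ) ρ ⊆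
        {r | ¬ (Tendsto (fun n => charFun (μ n) r) atTop (𝓝 (charFun μ₀ r)) ∧
          Tendsto (fun n => charFun (μ n) (t - r)) atTop (𝓝 (charFun μ₀ (t - r))))} :=
      fun r hr hh => hcon r hr hh.1 hh.2
    have hz := measure_mono_null hsub (ae_iff.1 (h.and hae))
    exact (Metric.measure_ball_pos volume (0 : ℝ) hρ).ne' hz
  have hrs := hball r hr
  have hre : Tendsto (fun n => 1 - (charFun (μ n) r).re) atTop (𝓝 (1 - (charFun μ₀ r).re)) :=
    tendsto_const_nhds.sub ((Complex.continuous_re.tendsto _).comp hr1)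
  filter_upwards [hre.eventually_lt_const hrs, (Metric.tendsto_nhds.1 hr2) ε hε] with n hn1 hn2
  have b1 := norm_charFun_sub_le (μ n) t (t - r) hε
  have b2 := norm_charFun_sub_le μ₀ t (t - r) hε
  rw [sub_sub_cancel] at b1 b2
  have aux : ∀ y, y < ε ^ 2 → y / (2 * ε) < ε := fun y hy => by
    rw [div_lt_iff₀ (by positivity)]; nlinarith [sq_nonneg ε]
  have c1 := aux _ hn1
  have c2 := aux _ hrs
  rw [dist_eq_norm] at hn2 ⊢
  have tri : ‖charFun (μ n) t - charFun μ₀ t‖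
      ≤ ‖charFun (μ n) t - charFun (μ n) (t - r)‖ +
        ‖charFun (μ n) (t - r) - charFun μ₀ (t - r)‖ + ‖charFun μ₀ t - charFun μ₀ (t - r)‖ := by
    rw [norm_sub_rev (charFun μ₀ t)]
    refine le_trans (le_of_eq ?_) (norm_add₃_le)
    congr 1; ring
  linarith

lemma norm_exp_mul_I_taylor_le (x : ℝ) :
    ‖Complex.exp (x * Complex.I) - (1 + x * Complex.I - x ^ 2 / 2)‖ ≤ 4 * |x| ^ 3 := by
  rcases le_total |x| 1 with h | h
  · have hz : ‖(x : ℂ) * Complex.I‖ = |x| := by simp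
    have := Complex.exp_bound (x := x * Complex.I) (by rw [hz]; exact h) (n := 3) (by norm_num)
    rw [hz] at this
    have e : ∑ m ∈ Finset.range 3, ((x : ℂ) * Complex.I) ^ m / (m.factorial : ℂ)
        = 1 + x * Complex.I - x ^ 2 / 2 := by
      simp only [Finset.sum_range_succ, Finset.sum_range_zero, mul_pow, Complex.I_sq,
        Nat.factorial]
      push_cast; ring
    rw [e] at this
    refine this.trans ?_
    rw [mul_comm]
    gcongr
    norm_num [Nat.factorial]
  · calc _ ≤ ‖Complex.exp (x * Complex.I)‖ + ‖(1 : ℂ) + x * Complex.I - x ^ 2 / 2‖ :=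
        norm_sub_le _ _
      _ ≤ 1 + (1 + |x| + |x| ^ 2 / 2) := by
        rw [Complex.norm_exp_ofReal_mul_I]
        gcongr
        refine (norm_sub_le _ _).trans (add_le_add ((norm_add_le _ _).trans ?_) ?_) <;> simp
      _ ≤ 4 * |x| ^ 3 := by
        nlinarith [mul_nonneg (sub_nonneg.2 h) (sub_nonneg.2 h),
          mul_nonneg (mul_nonneg (sub_nonneg.2 h) (sub_nonneg.2 h)) (abs_nonneg x)]

/-- Replace the factors one at a time; the others have modulus at most 1, so errors add. -/
lemma norm_prod_sub_pow_le {ι : Type*} (s : Finset ι) {f : ι → ℂ} {z : ℂ} {ε : ℝ}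
    (hf : ∀ a ∈ s, ‖f a‖ ≤ 1) (hz : ‖z‖ ≤ 1) (h : ∀ a ∈ s, ‖f a - z‖ ≤ ε) :
    ‖∏ a ∈ s, f a - z ^ s.card‖ ≤ s.card * ε := by
  classical
  induction s using Finset.induction_on with
  | empty => simp
  | insert a s ha ih =>
    rw [Finset.prod_insert ha, Finset.card_insert_of_notMem ha]
    have i := ih (fun b hb => hf b (Finset.mem_insert_of_mem hb))
      fun b hb => h b (Finset.mem_insert_of_mem hb)
    have e : f a * ∏ b ∈ s, f b - z ^ (s.card + 1)
        = f a * (∏ b ∈ s, f b - z ^ s.card) + (f a - z) * z ^ s.card := by ring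
    rw [e]
    have ha1 := hf a (Finset.mem_insert_self a s)
    have ha2 := h a (Finset.mem_insert_self a s)
    have hzp : ‖z ^ s.card‖ ≤ 1 := by rw [norm_pow]; exact pow_le_one₀ (norm_nonneg _) hz
    calc _ ≤ ‖f a‖ * ‖∏ b ∈ s, f b - z ^ s.card‖ + ‖f a - z‖ * ‖z ^ s.card‖ := by
          refine (norm_add_le _ _).trans ?_
          rw [norm_mul, norm_mul]
      _ ≤ 1 * (s.card * ε) + ε * 1 := by gcongr; exact (norm_nonneg _).trans ha2
      _ = _ := by push_cast; ring

lemma abs_exp_neg_sq_taylor_le {u : ℝ} (hu : |u| ≤ 1) :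
    |Real.exp (-(u ^ 2 / 2)) - (1 - u ^ 2 / 2)| ≤ |u| ^ 3 := by
  have hu2 : u ^ 2 ≤ 1 := by rw [← sq_abs]; exact pow_le_one₀ (abs_nonneg _) hu
  have h := Real.abs_exp_sub_one_sub_id_le (x := -(u ^ 2 / 2))
    (by rw [abs_neg, abs_of_nonneg (by positivity)]; linarith)
  have e : Real.exp (-(u ^ 2 / 2)) - (1 - u ^ 2 / 2)
      = Real.exp (-(u ^ 2 / 2)) - 1 - -(u ^ 2 / 2) := by ring
  rw [e]
  refine h.trans ?_
  have : (-(u ^ 2 / 2)) ^ 2 = |u| ^ 3 * (|u| / 4) := by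
    have := sq_abs u
    calc (-(u ^ 2 / 2)) ^ 2 = (u ^ 2) ^ 2 / 4 := by ring
      _ = (|u| ^ 2) ^ 2 / 4 := by rw [this]
      _ = _ := by ring
  rw [this]
  exact mul_le_of_le_one_right (by positivity) (by linarith)

section Moments

variable {Ω : Type*} [MeasurableSpace Ω] {P : Measure Ω} [IsProbabilityMeasure P] {W : Ω → ℝ}
  {p K : ℝ}

lemma abs_pow_le_one_add_rpow {j : ℕ} (hj : j ≤ p) (x : ℝ) : |x| ^ j ≤ 1 + |x| ^ p := by
  rcases le_total |x| 1 with h | h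
  · have := pow_le_one₀ (n := j) (abs_nonneg x) h
    have := Real.rpow_nonneg (abs_nonneg x) p
    linarith
  · have := Real.rpow_le_rpow_of_exponent_le h hj
    rw [Real.rpow_natCast] at this
    linarith

lemma integrable_abs_pow (hW : Measurable W) (hp : Integrable (fun ω => |W ω| ^ p) P) {j : ℕ}
    (hj : j ≤ p) : Integrable (fun ω => |W ω| ^ j) P := by
  refine Integrable.mono' ((integrable_const 1).add hp) (by fun_prop) (ae_of_all _ fun ω => ?_)
  rw [norm_pow, Real.norm_eq_abs, abs_abs]
  exact abs_pow_le_one_add_rpow hj _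

lemma integral_abs_pow_le (hW : Measurable W) (hp : Integrable (fun ω => |W ω| ^ p) P)
    (hK : ∫ ω, |W ω| ^ p ∂P ≤ K) {j : ℕ} (hj : j ≤ p) : ∫ ω, |W ω| ^ j ∂P ≤ 1 + K := by
  calc ∫ ω, |W ω| ^ j ∂P ≤ ∫ ω, (1 + |W ω| ^ p) ∂P :=
        integral_mono (integrable_abs_pow hW hp hj) ((integrable_const 1).add hp)
          fun ω => abs_pow_le_one_add_rpow hj _
    _ ≤ 1 + K := by
        rw [integral_add (integrable_const 1) hp]
        simpa using hK

lemma integrable_exp_mul_I (hW : Measurable W) (u : ℝ) :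
    Integrable (fun ω => Complex.exp ((u * W ω : ℝ) * Complex.I)) P :=
  integrable_of_norm_le (C := 1) (by fun_prop) fun _ => (Complex.norm_exp_ofReal_mul_I _).le

/-- Taylor expansion of the characteristic function of a standardized random variable. -/
lemma norm_integral_exp_sub_gaussian_le (hW : Measurable W)
    (hp : Integrable (fun ω => |W ω| ^ p) P) (hK : ∫ ω, |W ω| ^ p ∂P ≤ K) (hp3 : 3 ≤ p)
    (hK0 : 0 ≤ K) (hmean : ∫ ω, W ω ∂P = 0) (hvar : ∫ ω, W ω ^ 2 ∂P = 1) (u : ℝ) :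
    ‖∫ ω, Complex.exp ((u * W ω : ℝ) * Complex.I) ∂P - (Real.exp (-(u ^ 2 / 2)) : ℝ)‖
      ≤ (5 + 4 * K) * |u| ^ 3 := by
  rcases le_total |u| 1 with hu | hu
  swap
  · have h1 : ‖∫ ω, Complex.exp ((u * W ω : ℝ) * Complex.I) ∂P‖ ≤ 1 :=
      norm_integral_le_one fun ω => (Complex.norm_exp_ofReal_mul_I (u * W ω)).le
    have h2 : ‖((Real.exp (-(u ^ 2 / 2)) : ℝ) : ℂ)‖ ≤ 1 := by
      rw [Complex.norm_real, Real.norm_eq_abs, abs_of_pos (Real.exp_pos _), Real.exp_le_one_iff]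
      linarith [sq_nonneg u]
    have h3 : 1 ≤ |u| ^ 3 := one_le_pow₀ hu
    nlinarith [norm_sub_le (∫ ω, Complex.exp ((u * W ω : ℝ) * Complex.I) ∂P)
      ((Real.exp (-(u ^ 2 / 2)) : ℝ) : ℂ)]
  have i1 : Integrable (fun ω => |W ω|) P := by
    simpa using integrable_abs_pow hW hp (j := 1) (by norm_num; linarith)
  have i1' : Integrable W P := (integrable_norm_iff hW.aestronglyMeasurable).1 i1
  have i2 : Integrable (fun ω => W ω ^ 2) P := by
    simpa using integrable_abs_pow hW hp (j := 2) (by norm_num; linarith)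
  have i3 : Integrable (fun ω => |W ω| ^ 3) P :=
    integrable_abs_pow hW hp (j := 3) (by norm_num; linarith)
  have m3 : ∫ ω, |W ω| ^ 3 ∂P ≤ 1 + K :=
    integral_abs_pow_le hW hp hK (j := 3) (by norm_num; linarith)
  have j1 : Integrable (fun ω => ((u * W ω : ℝ) : ℂ) * Complex.I) P :=
    ((i1'.const_mul u).ofReal).mul_const _
  have j2 : Integrable (fun ω => ((u * W ω : ℝ) : ℂ) ^ 2 / 2) P := by
    have := ((i2.const_mul (u ^ 2)).ofReal (𝕜 := ℂ)).div_const 2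
    refine this.congr (ae_of_all _ fun ω => ?_)
    simp only [Complex.coe_algebraMap]
    push_cast; ring
  have j : Integrable (fun ω => 1 + ((u * W ω : ℝ) : ℂ) * Complex.I
      - ((u * W ω : ℝ) : ℂ) ^ 2 / 2) P := ((integrable_const 1).add j1).sub j2
  have hint : ∫ ω, (1 + ((u * W ω : ℝ) : ℂ) * Complex.I - ((u * W ω : ℝ) : ℂ) ^ 2 / 2) ∂P
      = ((1 - u ^ 2 / 2 : ℝ) : ℂ) := by
    have e1 : ∫ ω, ((u * W ω : ℝ) : ℂ) * Complex.I ∂P = 0 := by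
      rw [integral_mul_const, integral_complex_ofReal, integral_const_mul, hmean]; simp
    have e2 : ∫ ω, ((u * W ω : ℝ) : ℂ) ^ 2 / 2 ∂P = ((u ^ 2 / 2 : ℝ) : ℂ) := by
      have : ∀ ω, ((u * W ω : ℝ) : ℂ) ^ 2 / 2 = ((u ^ 2 / 2 * W ω ^ 2 : ℝ) : ℂ) := fun ω => by
        push_cast; ring
      simp only [this]
      rw [integral_complex_ofReal, integral_const_mul, hvar, mul_one]
    have j0 : Integrable (fun ω => 1 + ((u * W ω : ℝ) : ℂ) * Complex.I) P :=
      (integrable_const 1).add j1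
    rw [integral_sub j0 j2, integral_add (integrable_const 1) j1,
      e1, e2]
    simp
  have hmain : ‖∫ ω, Complex.exp ((u * W ω : ℝ) * Complex.I) ∂P - ((1 - u ^ 2 / 2 : ℝ) : ℂ)‖
      ≤ 4 * (1 + K) * |u| ^ 3 := by
    rw [← hint, ← integral_sub (integrable_exp_mul_I hW u) j]
    calc _ ≤ ∫ ω, ‖Complex.exp ((u * W ω : ℝ) * Complex.I) - (1 + ((u * W ω : ℝ) : ℂ) * Complex.I
            - ((u * W ω : ℝ) : ℂ) ^ 2 / 2)‖ ∂P := norm_integral_le_integral_norm _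
      _ ≤ ∫ ω, 4 * |u| ^ 3 * |W ω| ^ 3 ∂P := by
          refine integral_mono ((integrable_exp_mul_I hW u).sub j).norm (i3.const_mul _)
            fun ω => (norm_exp_mul_I_taylor_le _).trans (le_of_eq ?_)
          rw [abs_mul]; ring
      _ ≤ 4 * |u| ^ 3 * (1 + K) := by
          rw [integral_const_mul]; gcongr
      _ = _ := by ring
  have hg := abs_exp_neg_sq_taylor_le hu
  have hg' : ‖((Real.exp (-(u ^ 2 / 2)) : ℝ) : ℂ) - ((1 - u ^ 2 / 2 : ℝ) : ℂ)‖ ≤ |u| ^ 3 := by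
    rw [← Complex.ofReal_sub, Complex.norm_real]; exact hg
  rw [norm_sub_rev] at hg'
  have tri := norm_sub_le_norm_sub_add_norm_sub (∫ ω, Complex.exp ((u * W ω : ℝ) * Complex.I) ∂P)
    ((1 - u ^ 2 / 2 : ℝ) : ℂ) ((Real.exp (-(u ^ 2 / 2)) : ℝ) : ℂ)
  linarith

/-- The map x ↦ exp(ix) is 1-Lipschitz, so both terms are compared with 1, using E|W| ≤ (1 + E W²)/2
= 1 for the mean. -/
lemma norm_exp_sub_integral_le (hW : Measurable W) (hvar : ∫ ω, W ω ^ 2 ∂P = 1)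
    (i2 : Integrable (fun ω => W ω ^ 2) P) (u : ℝ) (ω : Ω) :
    ‖Complex.exp ((u * W ω : ℝ) * Complex.I)
      - ∫ ω, Complex.exp ((u * W ω : ℝ) * Complex.I) ∂P‖ ≤ |u| * (|W ω| + 1) := by
  have hle : ∀ x : ℝ, ‖Complex.exp (x * Complex.I) - 1‖ ≤ |x| := fun x => by
    rw [mul_comm]; exact Real.norm_exp_I_mul_ofReal_sub_one_le
  have i1 : Integrable (fun ω => |W ω|) P := by
    refine Integrable.mono' ((integrable_const 1).add i2) (by fun_prop) (ae_of_all _ fun ω => ?_)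
    rw [Real.norm_eq_abs, abs_abs]
    change |W ω| ≤ 1 + W ω ^ 2
    rw [← sq_abs]
    nlinarith [sq_nonneg (|W ω| - 1), sq_nonneg (|W ω|)]
  have m1 : ∫ ω, |W ω| ∂P ≤ 1 := by
    calc ∫ ω, |W ω| ∂P ≤ ∫ ω, (1 + W ω ^ 2) / 2 ∂P := by
          refine integral_mono i1 (((integrable_const 1).add i2).div_const 2) fun ω => ?_
          change |W ω| ≤ (1 + W ω ^ 2) / 2
          rw [← sq_abs]
          nlinarith [sq_nonneg (|W ω| - 1)]
      _ = 1 := by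
          rw [integral_div, integral_add (integrable_const 1) i2, hvar]; simp
  have h2 : ‖∫ ω, Complex.exp ((u * W ω : ℝ) * Complex.I) ∂P - 1‖ ≤ |u| := by
    have e : ∫ ω, Complex.exp ((u * W ω : ℝ) * Complex.I) ∂P - 1
        = ∫ ω, (Complex.exp ((u * W ω : ℝ) * Complex.I) - 1) ∂P := by
      rw [integral_sub (integrable_exp_mul_I hW u) (integrable_const 1)]; simp
    rw [e]
    calc _ ≤ ∫ ω, ‖Complex.exp ((u * W ω : ℝ) * Complex.I) - 1‖ ∂P :=
          norm_integral_le_integral_norm _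
      _ ≤ ∫ ω, |u| * |W ω| ∂P := by
          refine integral_mono ((integrable_exp_mul_I hW u).sub (integrable_const 1)).norm
            (i1.const_mul _) fun ω => (hle _).trans (abs_mul _ _).le
      _ ≤ |u| * 1 := by rw [integral_const_mul]; gcongr
      _ = |u| := mul_one _
  have h1 := hle (u * W ω)
  rw [abs_mul] at h1
  have tri := norm_sub_le_norm_sub_add_norm_sub (Complex.exp ((u * W ω : ℝ) * Complex.I)) 1
    (∫ ω, Complex.exp ((u * W ω : ℝ) * Complex.I) ∂P)
  rw [norm_sub_rev 1] at tri
  linarith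

lemma integral_norm_exp_sub_pow_le (hW : Measurable W)
    (hp : Integrable (fun ω => |W ω| ^ p) P) (hK : ∫ ω, |W ω| ^ p ∂P ≤ K)
    (hp2 : 2 ≤ p) (hvar : ∫ ω, W ω ^ 2 ∂P = 1) (u : ℝ) {j : ℕ} (hj : j ≤ p) :
    ∫ ω, ‖Complex.exp ((u * W ω : ℝ) * Complex.I)
      - ∫ ω, Complex.exp ((u * W ω : ℝ) * Complex.I) ∂P‖ ^ j ∂P
      ≤ |u| ^ j * (2 ^ (j - 1) * (2 + K)) := by
  have i2 : Integrable (fun ω => W ω ^ 2) P := by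
    simpa using integrable_abs_pow hW hp (j := 2) (by norm_num; linarith)
  have ij := integrable_abs_pow hW hp hj
  have hI : Integrable (fun ω => |u| ^ j * (2 ^ (j - 1) * (|W ω| ^ j + 1))) P :=
    ((ij.add (integrable_const 1)).const_mul _).const_mul _
  have hb : ∀ ω, ‖Complex.exp ((u * W ω : ℝ) * Complex.I)
      - ∫ ω, Complex.exp ((u * W ω : ℝ) * Complex.I) ∂P‖ ^ j
      ≤ |u| ^ j * (2 ^ (j - 1) * (|W ω| ^ j + 1)) := fun ω => by
    calc _ ≤ (|u| * (|W ω| + 1)) ^ j := by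
          gcongr; exact norm_exp_sub_integral_le hW hvar i2 u ω
      _ = |u| ^ j * (|W ω| + 1) ^ j := mul_pow _ _ _
      _ ≤ _ := by
          gcongr
          simpa using add_pow_le (abs_nonneg (W ω)) zero_le_one j
  calc _ ≤ ∫ ω, |u| ^ j * (2 ^ (j - 1) * (|W ω| ^ j + 1)) ∂P := by
        refine integral_mono (Integrable.mono' hI ?_ (ae_of_all _ fun ω => ?_)) hI hb
        · fun_prop
        · rw [norm_pow, norm_norm]; exact hb ω
    _ ≤ _ := by
        rw [integral_const_mul, integral_const_mul, integral_add ij (integrable_const 1)]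
        have h1 := integral_abs_pow_le hW hp hK hj
        have h2 : ∫ _ω, (1 : ℝ) ∂P = 1 := by simp
        exact mul_le_mul_of_nonneg_left (mul_le_mul_of_nonneg_left (by linarith) (by positivity))
          (by positivity)

end Moments

/-- A Borel–Cantelli type criterion for almost sure convergence to zero. -/
lemma ae_tendsto_zero_of_summable_integral {Ω : Type*} [MeasurableSpace Ω] {P : Measure Ω}
    {F : ℕ → Ω → ℝ} (hF : ∀ n, Measurable (F n)) (hF0 : ∀ n ω, 0 ≤ F n ω)
    (hI : ∀ n, Integrable (F n) P) {a : ℕ → ℝ} (ha : Summable a)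
    (h : ∀ᶠ n in atTop, ∫ ω, F n ω ∂P ≤ a n) :
    ∀ᵐ ω ∂P, Tendsto (fun n => F n ω) atTop (𝓝 0) := by
  -- After dropping finitely many terms, the sum of the variables has finite expectation, hence is
  -- almost surely finite, so its terms tend to 0.
  obtain ⟨N, hN⟩ := eventually_atTop.1 h
  have hsum : ∑' n, ∫⁻ ω, ENNReal.ofReal (F (n + N) ω) ∂P ≠ ⊤ := by
    have hs : Summable fun n => a (n + N) := (summable_nat_add_iff N).2 ha
    refine ne_top_of_le_ne_top hs.tsum_ofReal_ne_top (ENNReal.tsum_le_tsum fun n => ?_)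
    rw [← ofReal_integral_eq_lintegral_ofReal (hI _) (ae_of_all _ (hF0 _))]
    exact ENNReal.ofReal_le_ofReal (hN _ (Nat.le_add_left _ _))
  rw [← lintegral_tsum fun n => (hF _).ennreal_ofReal.aemeasurable] at hsum
  filter_upwards [ae_lt_top (Measurable.tsum fun n => (hF _).ennreal_ofReal) hsum]
    with ω hω
  have h0 := ENNReal.tendsto_atTop_zero_of_tsum_ne_top hω.ne
  have h1 := (ENNReal.tendsto_toReal ENNReal.zero_ne_top).comp h0
  rw [← tendsto_add_atTop_iff_nat N]
  simpa [Function.comp_def, ENNReal.toReal_ofReal (hF0 _ ω)] using h1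

/-! ### Correspondence between step sets and lattice paths -/

section Paths

open Finset

/-- The sequence of squares visited by the path with horizontal steps `R`. -/
def stepPath (n : ℕ) (R : Finset ℕ) (k : Fin n) : ℕ+ × ℕ+ := latticePoint R k

lemma card_inter_range_succ (R : Finset ℕ) (k : ℕ) :
    #(R ∩ range (k + 1)) = #(R ∩ range k) + if k ∈ R then 1 else 0 := by
  rw [range_add_one]
  split_ifs with h
  · rw [inter_insert_of_mem h, card_insert_of_notMem (by simp)]
  · rw [inter_insert_of_notMem h, add_zero]

lemma latticePoint_succ (R : Finset ℕ) (k : ℕ) :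
    latticePoint R (k + 1) = if k ∈ R then ((latticePoint R k).1 + 1, (latticePoint R k).2)
      else ((latticePoint R k).1, (latticePoint R k).2 + 1) := by
  have h := card_inter_range_succ R k
  have h' := card_inter_range_le R k
  split_ifs at h ⊢ with hk
  · refine Prod.ext (PNat.eq ?_) (PNat.eq ?_)
    · simp only [latticePoint, Nat.succPNat_coe, h, PNat.add_coe, PNat.one_coe]
    · simp only [latticePoint, Nat.succPNat_coe, h]; omega
  · refine Prod.ext (PNat.eq ?_) (PNat.eq ?_)
    · simp only [latticePoint, Nat.succPNat_coe, h, add_zero]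
    · simp only [latticePoint, Nat.succPNat_coe, h, PNat.add_coe, PNat.one_coe]; omega

lemma latticePoint_zero (R : Finset ℕ) : latticePoint R 0 = (1, 1) := by
  simp only [latticePoint, range_zero, inter_empty, card_empty, Nat.sub_zero]
  rfl

lemma sub_card_inter_range_mono (R : Finset ℕ) :
    Monotone fun k => k - #(R ∩ range k) := by
  refine monotone_nat_of_le_succ fun k => ?_
  have h := card_inter_range_succ R k
  have h' := card_inter_range_le R k
  split_ifs at h <;> omega

lemma stepPath_injOn {B m n : ℕ} (hn : n = 2 * m + 3) :
    Set.InjOn (stepPath n) (holeSteps B m : Set (Finset ℕ)) := by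
  intro R hR R' hR' h
  have hcard : ∀ k < n, #(R ∩ range k) = #(R' ∩ range k) := fun k hk => by
    have := congrArg (fun z => (z.1 : ℕ)) (congrFun h ⟨k, hk⟩)
    simpa [stepPath, latticePoint] using this
  have hmem : ∀ k < 2 * m + 2, (k ∈ R ↔ k ∈ R') := fun k hk => by
    have h1 := hcard k (by omega)
    have h2 := hcard (k + 1) (by omega)
    rw [card_inter_range_succ, card_inter_range_succ] at h2
    split_ifs at h2 <;> first | omega | simp_all
  simp only [holeSteps, coe_filter, mem_powerset, Set.mem_ofPred_eq] at hR hR'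
  ext k
  by_cases hk : k < 2 * m + 2
  · exact hmem k hk
  · exact iff_of_false (fun h => hk (mem_range.1 (hR.1 h))) fun h => hk (mem_range.1 (hR'.1 h))

lemma mem_holeDomain_iff {β : ℝ} {m : ℕ} {a : ℕ+ × ℕ+} :
    a ∈ holeDomain β (m + 2) ↔ (a.1 : ℕ) ≤ m + 2 ∧ (a.2 : ℕ) ≤ m + 2 ∧
      (2 * (a.1 : ℕ) + ⌊β * (m + 2 : ℕ)⌋₊ ≤ m + 2 ∨ m + 2 + ⌊β * (m + 2 : ℕ)⌋₊ ≤ 2 * (a.1 : ℕ) ∨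
        2 * (a.2 : ℕ) + ⌊β * (m + 2 : ℕ)⌋₊ ≤ m + 2 ∨
        m + 2 + ⌊β * (m + 2 : ℕ)⌋₊ ≤ 2 * (a.2 : ℕ)) := by
  unfold holeDomain
  simp only [Set.mem_ofPred_eq]
  refine and_congr_right fun _ => and_congr_right fun _ => ?_
  generalize ⌊β * ((m + 2 : ℕ) : ℝ)⌋₊ = B
  rw [le_max_iff, le_abs, le_abs, or_assoc]
  have key : ∀ x : ℕ, ((B : ℝ) / 2 ≤ x - ((m + 2 : ℕ) : ℝ) / 2 ↔ m + 2 + B ≤ 2 * x) ∧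
      ((B : ℝ) / 2 ≤ -(x - ((m + 2 : ℕ) : ℝ) / 2) ↔ 2 * x + B ≤ m + 2) := fun x => by
    rw [← Nat.cast_le (α := ℝ), ← Nat.cast_le (α := ℝ)]
    push_cast
    constructor <;> constructor <;> intro h <;> linarith
  rw [(key _).1, (key _).2, (key _).1, (key _).2]
  tauto

/-- Coordinates are monotone along a path. If it crosses the antidiagonal to the left of the hole,
it stays left of the hole before the crossing and, by the symmetry of the hole, above it afterwards.
The other case is the mirror image. -/
lemma stepPath_mem_holePaths {β : ℝ} {m : ℕ} {R : Finset ℕ}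
    (hR : R ∈ holeSteps ⌊β * (m + 2 : ℕ)⌋₊ m) :
    stepPath (m + 2 + (m + 2) - 1) R ∈ holePaths β (m + 2) := by
  simp only [holeSteps, mem_filter, mem_powerset] at hR
  obtain ⟨hsub, hcard, hcross⟩ := hR
  have hfull : R ∩ range (2 * m + 2) = R := inter_eq_left.2 hsub
  refine ⟨⟨?_, ?_, ?_⟩, ?_⟩
  · intro k hk
    rw [stepPath, hk, latticePoint_zero]
  · intro k hk
    have hk' : (k : ℕ) = 2 * m + 2 := by omega
    simp only [stepPath, latticePoint, hk', hfull, hcard, Nat.succPNat_coe, Nat.succ_eq_add_one, true_and]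
    omega
  · intro k l hkl
    simp only [stepPath, hkl, latticePoint_succ]
    split_ifs
    · exact Or.inl rfl
    · exact Or.inr rfl
  · intro k
    have hk : (k : ℕ) ≤ 2 * m + 2 := by omega
    have h1 := card_inter_range_mono R hk
    rw [hfull, hcard] at h1
    have h2 := card_inter_range_le R k
    have h3 := sub_card_inter_range_mono R hk
    simp only [hfull, hcard] at h3
    rw [mem_holeDomain_iff]
    simp only [stepPath, latticePoint, Nat.succPNat_coe]
    generalize ⌊β * ((m + 2 : ℕ) : ℝ)⌋₊ = B at hcross
    have h6 := card_inter_range_le R m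
    rcases le_total (k : ℕ) m with hkm | hkm
    · have h7 := card_inter_range_mono R hkm
      have h8 : (k : ℕ) - #(R ∩ range k) ≤ m - #(R ∩ range m) := sub_card_inter_range_mono R hkm
      omega
    · have h7 := card_inter_range_mono R hkm
      have h8 : m - #(R ∩ range m) ≤ (k : ℕ) - #(R ∩ range k) := sub_card_inter_range_mono R hkm
      omega

/-- The horizontal steps are the times at which the first coordinate grows, and they determine the
path. -/
lemma exists_stepPath_eq {β : ℝ} {m : ℕ} {σ : Fin (m + 2 + (m + 2) - 1) → ℕ+ × ℕ+}
    (hσ : σ ∈ holePaths β (m + 2)) :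
    ∃ R ∈ holeSteps ⌊β * (m + 2 : ℕ)⌋₊ m, stepPath (m + 2 + (m + 2) - 1) R = σ := by
  obtain ⟨hpath, hdom⟩ := hσ
  set R : Finset ℕ := {k ∈ range (2 * m + 2) | ∃ h : k + 1 < m + 2 + (m + 2) - 1,
    (σ ⟨k + 1, h⟩).1 = (σ ⟨k, by omega⟩).1 + 1} with hRdef
  have hne : ∀ a : ℕ+, a ≠ a + 1 := fun a h => by
    have := congrArg PNat.val h
    simp at this
  have hmem : ∀ k (h : k + 1 < m + 2 + (m + 2) - 1),
      (k ∈ R ↔ (σ ⟨k + 1, h⟩).1 = (σ ⟨k, by omega⟩).1 + 1) := fun k h => by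
    simp only [hRdef, mem_filter, mem_range]
    exact ⟨fun hh => hh.2.2, fun hh => ⟨by omega, h, hh⟩⟩
  have heq : ∀ k (h : k < m + 2 + (m + 2) - 1), latticePoint R k = σ ⟨k, h⟩ := by
    intro k
    induction k with
    | zero =>
      intro h
      rw [hpath.start ⟨0, h⟩ rfl, latticePoint_zero]
    | succ k ih =>
      intro h
      rw [latticePoint_succ, ih (by omega)]
      rcases hpath.step ⟨k, by omega⟩ ⟨k + 1, h⟩ rfl with hs | hs
      · have : k ∈ R := (hmem k h).2 (by rw [hs])
        rw [if_pos this, hs]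
      · have : k ∉ R := fun hk => by
          rw [hmem k h, hs] at hk
          exact hne _ hk
        rw [if_neg this, hs]
  have hsub : R ⊆ range (2 * m + 2) := filter_subset _ _
  have hfull : R ∩ range (2 * m + 2) = R := inter_eq_left.2 hsub
  have hend := hpath.finish ⟨2 * m + 2, by omega⟩ (by simp only; omega)
  rw [← heq] at hend
  simp only [latticePoint, Nat.succPNat_coe, hfull] at hend
  -- The square at index m lies on the antidiagonal i + j = m + 2, where the four alternatives in
  -- `mem_holeDomain_iff` reduce to two.
  have hcross := hdom ⟨m, by omega⟩
  rw [← heq, mem_holeDomain_iff] at hcross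
  simp only [latticePoint, Nat.succPNat_coe] at hcross
  refine ⟨R, ?_, funext fun k => heq k k.2⟩
  simp only [holeSteps, mem_filter, mem_powerset]
  refine ⟨hsub, by omega, ?_⟩
  generalize ⌊β * ((m + 2 : ℕ) : ℝ)⌋₊ = B at hcross ⊢
  have := card_inter_range_le R m
  omega

open Classical in
lemma holePaths_eq_image (β : ℝ) (m : ℕ) :
    holePaths β (m + 2) = ((holeSteps ⌊β * (m + 2 : ℕ)⌋₊ m).image
      (stepPath (m + 2 + (m + 2) - 1)) : Set (Fin (m + 2 + (m + 2) - 1) → ℕ+ × ℕ+)) := by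
  ext σ
  simp only [coe_image, Set.mem_image, mem_coe]
  constructor
  · exact fun h => exists_stepPath_eq h
  · rintro ⟨R, hR, rfl⟩
    exact stepPath_mem_holePaths hR

lemma integral_uniformOn_finset {S : Type*} [MeasurableSpace S] [MeasurableSingletonClass S]
    [DecidableEq S] (T : Finset S) (f : S → ℂ) :
    ∫ σ, f σ ∂(uniformOn (T : Set S)) = (#T : ℂ)⁻¹ * ∑ σ ∈ T, f σ := by
  rw [uniformOn, ProbabilityTheory.cond, integral_smul_measure, setIntegral_finset]
  · simp only [Measure.count_apply_finset, ENNReal.toReal_inv, ENNReal.toReal_natCast,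
      Measure.real, Measure.count_singleton, ENNReal.toReal_one, one_smul]
    rw [Complex.real_smul]
    push_cast
    rfl
  · rw [← (T : Set S).biUnion_of_singleton]
    exact (integrableOn_finset_iUnion (s := T) (t := fun x => {x})).2 fun x _ =>
      integrableOn_singleton (hx := by rw [Measure.count_singleton]; exact ENNReal.one_lt_top)

/-- With N = m + 2 there are 2m + 3 = 2N - 1 squares, all distinct, so the exponential of the energy
is a product over the set of visited squares. -/
lemma charFun_quenchedLaw (β : ℝ) (w : ℕ+ × ℕ+ → ℝ) (m : ℕ) (t : ℝ) :
    charFun (quenchedLaw β w (m + 2) : Measure ℝ) t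
      = (#(holeSteps ⌊β * (m + 2 : ℕ)⌋₊ m) : ℂ)⁻¹ * ∑ R ∈ holeSteps ⌊β * (m + 2 : ℕ)⌋₊ m,
        ∏ a ∈ visited (2 * m + 3) R,
          Complex.exp ((t / √(2 * m + 3) * w a : ℝ) * Complex.I) := by
  classical
  change charFun ((uniformOn (holePaths β (m + 2))).map _) t = _
  have hmeas : Measurable fun σ : Fin (m + 2 + (m + 2) - 1) → ℕ+ × ℕ+ =>
      (1 / √(2 * ((m + 2 : ℕ) : ℝ) - 1)) * pathEnergy w σ := measurable_of_countable _
  rw [charFun_apply_real, integral_map hmeas.aemeasurable (by fun_prop), holePaths_eq_image,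
    integral_uniformOn_finset, card_image_of_injOn (stepPath_injOn (by omega)),
    sum_image (stepPath_injOn (by omega))]
  congr 1
  refine sum_congr rfl fun R _ => ?_
  rw [visited, prod_image (latticePoint_injective R).injOn, ← Complex.exp_sum]
  congr 1
  rw [← sum_mul]
  congr 1
  have hsum : pathEnergy w (stepPath (m + 2 + (m + 2) - 1) R)
      = ∑ k ∈ range (2 * m + 3), w (latticePoint R k) := by
    rw [pathEnergy, show 2 * m + 3 = m + 2 + (m + 2) - 1 by omega]
    exact Fin.sum_univ_eq_sum_range (fun k => w (latticePoint R k)) _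
  rw [hsum]
  norm_cast
  rw [← mul_sum, ← mul_assoc]
  congr 1
  push_cast
  rw [show 2 * ((m : ℝ) + 2) - 1 = 2 * m + 3 by ring, mul_one_div]

lemma isProbabilityMeasure_quenchedLaw {β : ℝ} {m : ℕ} (w : ℕ+ × ℕ+ → ℝ)
    (h : (holeSteps ⌊β * (m + 2 : ℕ)⌋₊ m).Nonempty) :
    IsProbabilityMeasure (quenchedLaw β w (m + 2) : Measure ℝ) := by
  classical
  have hmeas : Measurable fun σ : Fin (m + 2 + (m + 2) - 1) → ℕ+ × ℕ+ =>
      (1 / √(2 * ((m + 2 : ℕ) : ℝ) - 1)) * pathEnergy w σ := measurable_of_countable _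
  have hu : IsProbabilityMeasure (uniformOn (holePaths β (m + 2))) := by
    rw [holePaths_eq_image]
    exact isProbabilityMeasure_uniformOn (finite_toSet _) (coe_nonempty.2 (h.image _))
  exact Measure.isProbabilityMeasure_map hmeas.aemeasurable

end Paths

/-! ### Almost sure convergence of the quenched characteristic functions -/

/-- The average over hole-avoiding paths of `exp (i t H / √n)`, where `H` is the energy and `n` the
number of squares of the path. -/
noncomputable def averagedExp (β : ℝ) (w : ℕ+ × ℕ+ → ℝ) (m : ℕ) (t : ℝ) : ℂ :=
  ((holeSteps ⌊β * (m + 2 : ℕ)⌋₊ m).card : ℂ)⁻¹ * ∑ R ∈ holeSteps ⌊β * (m + 2 : ℕ)⌋₊ m,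
    ∏ a ∈ visited (2 * m + 3) R, Complex.exp ((t / √(2 * m + 3) * w a : ℝ) * Complex.I)

/-- The expectation of `averagedExp` in a random environment with independent weights. -/
noncomputable def annealedExp {Ω : Type*} [MeasurableSpace Ω] (β : ℝ) (P : Measure Ω)
    (w : ℕ+ × ℕ+ → Ω → ℝ) (m : ℕ) (t : ℝ) : ℂ :=
  ∑ R ∈ holeSteps ⌊β * (m + 2 : ℕ)⌋₊ m,
    ((holeSteps ⌊β * (m + 2 : ℕ)⌋₊ m).card : ℂ)⁻¹ * ∏ a ∈ visited (2 * m + 3) R,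
      ∫ ω, Complex.exp ((t / √(2 * m + 3) * w a ω : ℝ) * Complex.I) ∂P

lemma card_visited (n : ℕ) (R : Finset ℕ) : (visited n R).card = n := by
  rw [visited, Finset.card_image_of_injective _ (latticePoint_injective R), Finset.card_range]

lemma sqrt_div_self_pow_three {x : ℝ} (hx : 0 < x) : (√x / x) ^ 3 = 1 / x ^ (3 / 2 : ℝ) := by
  have h1 : √x / x = 1 / √x := by
    rw [div_eq_div_iff hx.ne' (Real.sqrt_pos.2 hx).ne', one_mul, Real.mul_self_sqrt hx.le]
  have h2 : x ^ (3 / 2 : ℝ) = √x ^ 3 := by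
    rw [Real.sqrt_eq_rpow, ← Real.rpow_natCast, ← Real.rpow_mul hx.le]
    norm_num
  rw [h1, h2, div_pow, one_pow]

lemma sq_mul_mul_div_pow_three {s : ℝ} (hs : s ≠ 0) (x y : ℝ) :
    s ^ 2 * (x * (y / s) ^ 3) = x * y ^ 3 * s⁻¹ := by
  field_simp

lemma measurable_averagedExp {Ω : Type*} [MeasurableSpace Ω] {w : ℕ+ × ℕ+ → Ω → ℝ}
    (hw : ∀ a, Measurable (w a)) (β : ℝ) (m : ℕ) :
    Measurable fun x : Ω × ℝ => averagedExp β (fun a => w a x.1) m x.2 := by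
  unfold averagedExp
  refine Measurable.const_mul (Finset.measurable_sum _ fun R _ =>
    Finset.measurable_prod _ fun a _ => ?_) _
  have := hw a
  fun_prop

lemma norm_averagedExp_le (β : ℝ) (w : ℕ+ × ℕ+ → ℝ) (m : ℕ) (t : ℝ) :
    ‖averagedExp β w m t‖ ≤ 1 := by
  unfold averagedExp
  set T := holeSteps ⌊β * (m + 2 : ℕ)⌋₊ m
  have h : ‖∑ R ∈ T, ∏ a ∈ visited (2 * m + 3) R,
      Complex.exp ((t / √(2 * m + 3) * w a : ℝ) * Complex.I)‖ ≤ T.card := by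
    refine (norm_sum_le _ _).trans ?_
    simp only [norm_prod, Complex.norm_exp_ofReal_mul_I, Finset.prod_const_one, Finset.sum_const,
      nsmul_eq_mul, mul_one, le_refl]
  rw [norm_mul, norm_inv, Complex.norm_natCast]
  calc _ ≤ (T.card : ℝ)⁻¹ * T.card := by gcongr
    _ ≤ 1 := inv_mul_le_one

section QuenchedLimit

variable {Ω : Type*} [MeasurableSpace Ω] {P : Measure Ω} [IsProbabilityMeasure P]
  {w : ℕ+ × ℕ+ → Ω → ℝ} {p K β : ℝ}

/-- The annealed averages converge to the Gaussian characteristic function. -/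
lemma tendsto_annealedExp (hp : 3 ≤ p) (hK : 0 ≤ K) (hβ : β ∈ Set.Ioo (0 : ℝ) 1)
    (hw_meas : ∀ a, Measurable (w a)) (hw_mean : ∀ a, ∫ ω, w a ω ∂P = 0)
    (hw_var : ∀ a, ∫ ω, (w a ω) ^ 2 ∂P = 1)
    (hw_int : ∀ a, Integrable (fun ω => |w a ω| ^ p) P)
    (hw_mom : ∀ a, ∫ ω, |w a ω| ^ p ∂P ≤ K) (t : ℝ) :
    Tendsto (fun m : ℕ => annealedExp β P w m t) atTop (𝓝 (Real.exp (-(t ^ 2 / 2)) : ℝ)) := by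
  obtain ⟨C, -, hC⟩ := exists_overlap_bound hβ
  unfold annealedExp
  rw [tendsto_iff_norm_sub_tendsto_zero]
  have hlim : Tendsto (fun m : ℕ => (5 + 4 * K) * |t| ^ 3 * (√(2 * (m : ℝ) + 3))⁻¹) atTop (𝓝 0) := by
    have h1 : Tendsto (fun m : ℕ => 2 * (m : ℝ) + 3) atTop atTop :=
      tendsto_atTop_add_const_right _ _
        (tendsto_natCast_atTop_atTop.const_mul_atTop (by norm_num))
    have := (tendsto_inv_atTop_zero.comp (Real.tendsto_sqrt_atTop.comp h1)).const_mul
      ((5 + 4 * K) * |t| ^ 3)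
    simpa [Function.comp_def] using this
  refine squeeze_zero' (Eventually.of_forall fun _ => norm_nonneg _) ?_ hlim
  filter_upwards [hC] with m hm
  obtain ⟨hne, -⟩ := hm
  set T := holeSteps ⌊β * (m + 2 : ℕ)⌋₊ m
  have hT : (T.card : ℂ) ≠ 0 := by exact_mod_cast (Finset.card_pos.2 hne).ne'
  have hTr : (0 : ℝ) < T.card := by exact_mod_cast Finset.card_pos.2 hne
  set s := √(2 * (m : ℝ) + 3) with hs
  have hs0 : 0 < s := Real.sqrt_pos.2 (by positivity)
  have hs2 : s ^ 2 = 2 * m + 3 := Real.sq_sqrt (by positivity)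
  set z : ℂ := ((Real.exp (-((t / s) ^ 2 / 2)) : ℝ) : ℂ) with hz
  have hzn : z ^ (2 * m + 3) = ((Real.exp (-(t ^ 2 / 2)) : ℝ) : ℂ) := by
    rw [hz, ← Complex.ofReal_pow, ← Real.exp_nat_mul]
    congr 2
    push_cast
    rw [← hs2]
    field_simp
  have hz1 : ‖z‖ ≤ 1 := by
    rw [hz, Complex.norm_real, Real.norm_eq_abs, abs_of_pos (Real.exp_pos _), Real.exp_le_one_iff]
    have : 0 ≤ (t / s) ^ 2 := sq_nonneg _
    linarith
  have hterm : ∀ R ∈ T, ‖∏ a ∈ visited (2 * m + 3) R,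
      ∫ ω, Complex.exp ((t / s * w a ω : ℝ) * Complex.I) ∂P
        - ((Real.exp (-(t ^ 2 / 2)) : ℝ) : ℂ)‖ ≤ (5 + 4 * K) * |t| ^ 3 * s⁻¹ := by
    intro R _
    have h := norm_prod_sub_pow_le (visited (2 * m + 3) R)
      (f := fun a => ∫ ω, Complex.exp ((t / s * w a ω : ℝ) * Complex.I) ∂P) (z := z)
      (ε := (5 + 4 * K) * |t / s| ^ 3)
      (fun a _ => norm_integral_le_one fun ω =>
        (Complex.norm_exp_ofReal_mul_I (t / s * w a ω)).le)
      hz1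
      (fun a _ => norm_integral_exp_sub_gaussian_le (hw_meas a) (hw_int a) (hw_mom a) hp hK
        (hw_mean a) (hw_var a) _)
    rw [card_visited, hzn] at h
    refine h.trans (le_of_eq ?_)
    push_cast
    rw [← hs2, abs_div, abs_of_pos hs0]
    exact sq_mul_mul_div_pow_three hs0.ne' _ _
  have hconst : ((Real.exp (-(t ^ 2 / 2)) : ℝ) : ℂ)
      = ∑ _R ∈ T, (T.card : ℂ)⁻¹ * ((Real.exp (-(t ^ 2 / 2)) : ℝ) : ℂ) := by
    rw [Finset.sum_const, nsmul_eq_mul, mul_inv_cancel_left₀ hT]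
  rw [hconst, ← Finset.sum_sub_distrib]
  calc _ ≤ ∑ _R ∈ T, (T.card : ℝ)⁻¹ * ((5 + 4 * K) * |t| ^ 3 * s⁻¹) := by
        refine norm_sum_le_of_le _ fun R hR => ?_
        rw [← mul_sub, norm_mul, norm_inv, Complex.norm_natCast]
        exact mul_le_mul_of_nonneg_left (hterm R hR) (inv_nonneg.2 hTr.le)
    _ = _ := by rw [Finset.sum_const, nsmul_eq_mul, mul_inv_cancel_left₀ hTr.ne']

/-- The fluctuations of an average of exponentials of sums of independent variables are controlled
by the overlaps of the index sets. -/
lemma average_exp_sixth_moment {ι τ : Type*} [DecidableEq ι] {w : ι → Ω → ℝ}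
    (hp : 6 ≤ p) (hK : 0 ≤ K) (hw_meas : ∀ a, Measurable (w a)) (hw_indep : iIndepFun w P)
    (hw_var : ∀ a, ∫ ω, (w a ω) ^ 2 ∂P = 1)
    (hw_int : ∀ a, Integrable (fun ω => |w a ω| ^ p) P)
    (hw_mom : ∀ a, ∫ ω, |w a ω| ^ p ∂P ≤ K) {T : Finset τ} {A : τ → Finset ι} {V : ℝ}
    (hne : T.Nonempty)
    (hV : ∀ U : Finset ι, ∑ a ∈ U, ((T.filter fun R => a ∈ A R).card : ℝ) ^ 2
        ≤ V * (T.card : ℝ) ^ 2) (u : ℝ) :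
    ∫ ω, ‖(T.card : ℂ)⁻¹ * ∑ R ∈ T, ∏ a ∈ A R, Complex.exp ((u * w a ω : ℝ) * Complex.I)
        - ∑ R ∈ T, (T.card : ℂ)⁻¹ * ∏ a ∈ A R,
          ∫ ω, Complex.exp ((u * w a ω : ℝ) * Complex.I) ∂P‖ ^ 6 ∂P
      ≤ 8 * (9 * (8 * (2 + K) * u ^ 2) * V) ^ 3 := by
  set X : ι → Ω → ℂ := fun a ω => Complex.exp ((u * w a ω : ℝ) * Complex.I) with hXdef
  set c : ι → ℂ := fun a => ∫ ω, X a ω ∂P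
  set ν : τ → ℂ := fun _ => (T.card : ℂ)⁻¹ with hνdef
  set U : Finset ι := T.biUnion A
  have hXm : ∀ a, Measurable (X a) := fun a => by
    have := hw_meas a
    simp only [hXdef]
    fun_prop
  have hX1 : ∀ a ω, ‖X a ω‖ ≤ 1 := fun a ω => (Complex.norm_exp_ofReal_mul_I _).le
  have hXind : iIndepFun X P :=
    hw_indep.comp (fun _ x => Complex.exp ((u * x : ℝ) * Complex.I)) fun _ => by fun_prop
  have hφ : ∀ ω, (T.card : ℂ)⁻¹ * ∑ R ∈ T, ∏ a ∈ A R, X a ω = partialAverage X c T ν A U ω := by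
    intro ω
    unfold partialAverage
    rw [Finset.mul_sum]
    refine Finset.sum_congr rfl fun R hR => ?_
    congr 1
    refine Finset.prod_congr rfl fun a ha => ?_
    rw [if_pos (Finset.mem_biUnion.2 ⟨R, hR, ha⟩)]
  have hψ : ∀ ω, ∑ R ∈ T, (T.card : ℂ)⁻¹ * ∏ a ∈ A R, c a = partialAverage X c T ν A ∅ ω := by
    intro ω
    simp only [partialAverage, Finset.notMem_empty, if_false, hνdef]
  have hTr : (0 : ℝ) < T.card := by exact_mod_cast Finset.card_pos.2 hne
  have hmom : ∀ j : ℕ, j ≤ 6 → ∀ a, ∫ ω, ‖X a ω - c a‖ ^ j ∂P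
      ≤ |u| ^ j * (2 ^ (j - 1) * (2 + K)) := fun j hj a =>
    integral_norm_exp_sub_pow_le (hw_meas a) (hw_int a) (hw_mom a) (by linarith) (hw_var a) _
      (by
        have : (j : ℝ) ≤ 6 := by exact_mod_cast hj
        linarith)
  have hu2 : |u| ^ 2 = u ^ 2 := sq_abs _
  have hu4 : |u| ^ 4 = (u ^ 2) ^ 2 := by rw [← hu2]; ring
  have hu6 : |u| ^ 6 = (u ^ 2) ^ 3 := by rw [← hu2]; ring
  have hK2 : 1 ≤ 2 + K := by linarith
  have hK2' : 1 ≤ (2 + K) ^ 2 := one_le_pow₀ hK2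
  -- The moments of order 2, 4, 6 carry the constants 2, 8, 32 times 2 + K; since 2 + K ≥ 1, they
  -- are dominated by the powers 1, 2, 3 of 8(2 + K).
  have hsix := partialAverage_sixth_moment (T := T) (ν := ν) (A := A) hXm hXind
    hX1 (c := c) (fun a => rfl) (δ := 8 * (2 + K) * u ^ 2) (by positivity)
    (fun a => (hmom 2 (by norm_num) a).trans (by
      rw [hu2, mul_comm]
      gcongr
      norm_num))
    (fun a => (hmom 4 (by norm_num) a).trans (by
      rw [hu4, mul_pow, mul_comm]
      gcongr
      norm_num
      nlinarith))
    (fun a => (hmom 6 (by norm_num) a).trans (by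
      rw [hu6, mul_pow, mul_comm]
      gcongr
      norm_num
      nlinarith))
    U
  simp only [← hφ, ← hψ] at hsix
  refine hsix.trans ?_
  have hvis : ∑ a ∈ U, (∑ R ∈ T with a ∈ A R, ‖ν R‖) ^ 2 ≤ V := by
    have e : ∀ a ∈ U, (∑ R ∈ T with a ∈ A R, ‖ν R‖) ^ 2
        = ((T.filter fun R => a ∈ A R).card : ℝ) ^ 2 / (T.card : ℝ) ^ 2 := fun a _ => by
      simp only [hνdef]
      rw [Finset.sum_const, nsmul_eq_mul, norm_inv, Complex.norm_natCast, mul_pow, inv_pow,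
        div_eq_mul_inv]
    rw [Finset.sum_congr rfl e, ← Finset.sum_div, div_le_iff₀ (by positivity)]
    exact hV U
  gcongr

/-- Almost sure convergence of bounded variables whose sixth central moments are of the order
`m ^ (-3 / 2)`. -/
lemma ae_tendsto_of_sixth_moment {φ : ℕ → Ω → ℂ} {ψ : ℕ → ℂ} {z : ℂ} {t C : ℝ}
    (hφ : ∀ m, Measurable (φ m)) (hφ1 : ∀ m ω, ‖φ m ω‖ ≤ 1) (hψ : Tendsto ψ atTop (𝓝 z))
    (hC : 0 < C) (hK : 0 ≤ K)
    (hmoment : ∀ᶠ m : ℕ in atTop, ∫ ω, ‖φ m ω - ψ m‖ ^ 6 ∂P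
      ≤ 8 * (9 * (8 * (2 + K) * (t / √(2 * m + 3)) ^ 2) * (C * √m)) ^ 3) :
    ∀ᵐ ω ∂P, Tendsto (fun m => φ m ω) atTop (𝓝 z) := by
  have hFm : ∀ m, Measurable fun ω => ‖φ m ω - ψ m‖ ^ 6 :=
    fun m => ((hφ m).sub_const _).norm.pow_const 6
  have hFI : ∀ m, Integrable (fun ω => ‖φ m ω - ψ m‖ ^ 6) P :=
    fun m => integrable_of_norm_le (hFm m) (C := (1 + ‖ψ m‖) ^ 6) fun ω => by
      rw [norm_pow, norm_norm]
      gcongr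
      exact (norm_sub_le _ _).trans (add_le_add_left (hφ1 m ω) _)
  set D : ℝ := 9 * (8 * (2 + K) * t ^ 2) * C with hD
  have hbound : ∀ᶠ m : ℕ in atTop, ∫ ω, ‖φ m ω - ψ m‖ ^ 6 ∂P
      ≤ 8 * D ^ 3 * (1 / (m : ℝ) ^ (3 / 2 : ℝ)) := by
    filter_upwards [hmoment, eventually_ge_atTop 1] with m hm hm1
    have hm0 : (0 : ℝ) < m := by exact_mod_cast hm1
    refine hm.trans ?_
    rw [← sqrt_div_self_pow_three hm0, mul_assoc 8 (D ^ 3), ← mul_pow]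
    have hu : (t / √(2 * m + 3)) ^ 2 ≤ t ^ 2 / m := by
      rw [div_pow, Real.sq_sqrt (by positivity)]
      gcongr
      linarith
    refine mul_le_mul_of_nonneg_left (pow_le_pow_left₀ (by positivity) ?_ 3) (by norm_num)
    calc 9 * (8 * (2 + K) * (t / √(2 * m + 3)) ^ 2) * (C * √m)
        ≤ 9 * (8 * (2 + K) * (t ^ 2 / m)) * (C * √m) := by gcongr
      _ = D * (√m / m) := by rw [hD]; ring
  -- The sixth moment is what makes this summable: the analogous fourth moment bound would be of
  -- order 1/m.
  have hsummable : Summable fun m : ℕ => 8 * D ^ 3 * (1 / (m : ℝ) ^ (3 / 2 : ℝ)) :=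
    (Real.summable_one_div_nat_rpow.2 (by norm_num)).mul_left _
  filter_upwards [ae_tendsto_zero_of_summable_integral hFm (fun m ω => by positivity) hFI
    hsummable hbound] with ω hω
  have hdiff : Tendsto (fun m => φ m ω - ψ m) atTop (𝓝 0) := by
    rw [tendsto_zero_iff_norm_tendsto_zero]
    have := (Real.continuousAt_rpow_const 0 (1 / 6 : ℝ) (Or.inr (by norm_num))).tendsto.comp hω
    rw [Real.zero_rpow (by norm_num)] at this
    refine this.congr fun m => ?_
    rw [Function.comp_apply, ← Real.rpow_natCast, ← Real.rpow_mul (norm_nonneg _)]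
    norm_num
  simpa using hdiff.add hψ

/-- For a fixed argument, the quenched characteristic functions converge almost surely. -/
lemma ae_tendsto_averagedExp (hp : 6 ≤ p) (hK : 0 ≤ K) (hβ : β ∈ Set.Ioo (0 : ℝ) 1)
    (hw_meas : ∀ a, Measurable (w a)) (hw_indep : iIndepFun w P)
    (hw_mean : ∀ a, ∫ ω, w a ω ∂P = 0) (hw_var : ∀ a, ∫ ω, (w a ω) ^ 2 ∂P = 1)
    (hw_int : ∀ a, Integrable (fun ω => |w a ω| ^ p) P)
    (hw_mom : ∀ a, ∫ ω, |w a ω| ^ p ∂P ≤ K) (t : ℝ) :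
    ∀ᵐ ω ∂P, Tendsto (fun m : ℕ => averagedExp β (fun a => w a ω) m t) atTop
      (𝓝 (Real.exp (-(t ^ 2 / 2)) : ℝ)) := by
  have hψ := tendsto_annealedExp (by linarith) hK hβ hw_meas hw_mean hw_var hw_int
    hw_mom t
  obtain ⟨C, hC0, hC⟩ := exists_overlap_bound hβ
  have hmoment : ∀ᶠ m : ℕ in atTop,
      ∫ ω, ‖averagedExp β (fun a => w a ω) m t - annealedExp β P w m t‖ ^ 6 ∂P
      ≤ 8 * (9 * (8 * (2 + K) * (t / √(2 * m + 3)) ^ 2) * (C * √m)) ^ 3 := by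
    filter_upwards [hC] with m hm
    unfold averagedExp annealedExp
    exact average_exp_sixth_moment (T := holeSteps ⌊β * (m + 2 : ℕ)⌋₊ m)
      (A := visited (2 * m + 3)) hp hK hw_meas hw_indep hw_var hw_int hw_mom hm.1 hm.2
      (t / √(2 * m + 3))
  have hmeas : ∀ m, Measurable fun ω => averagedExp β (fun a => w a ω) m t := fun m =>
    Measurable.comp (g := fun x : Ω × ℝ => averagedExp β (fun a => w a x.1) m x.2)
      (f := fun ω => (ω, t)) (measurable_averagedExp hw_meas β m) measurable_prodMk_right
  exact ae_tendsto_of_sixth_moment (t := t) (φ := fun m ω => averagedExp β (fun a => w a ω) m t)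
    (ψ := fun m => annealedExp β P w m t) hmeas (fun m ω => norm_averagedExp_le _ _ _ _) hψ hC0 hK
    hmoment

end QuenchedLimit

theorem theorem1p3 {Ω : Type*} [MeasurableSpace Ω] (P : Measure Ω) [IsProbabilityMeasure P]
    (w : ℕ+ × ℕ+ → Ω → ℝ) (p K β : ℝ) (hp : 12 < p) (hK : 0 < K) (hβ : β ∈ Set.Ioo (0 : ℝ) 1)
    (hw_meas : ∀ a, Measurable (w a))
    (hw_indep : iIndepFun w P)
    (hw_mean : ∀ a, ∫ ω, w a ω ∂P = 0)
    (hw_var : ∀ a, ∫ ω, (w a ω) ^ 2 ∂P = 1)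
    (hw_mom : ∀ a, Integrable (fun ω => |w a ω| ^ p) P ∧ ∫ ω, |w a ω| ^ p ∂P ≤ K) :
    ∀ᵐ ω ∂P, Tendsto (fun N : ℕ => quenchedLaw β (fun a => w a ω) N) atTop (𝓝 stdNormal) := by
  have hset : MeasurableSet {x : Ω × ℝ | Tendsto
      (fun m : ℕ => averagedExp β (fun a => w a x.1) m x.2) atTop
        (𝓝 (Real.exp (-(x.2 ^ 2 / 2)) : ℝ))} :=
    measurableSet_tendsto_fun (measurable_averagedExp hw_meas β) (by fun_prop)
  -- Fubini: the exceptional null set of environments depends on t, but almost every environment is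
  -- good for almost every t.
  have hae := (Measure.ae_ae_comm (μ := P) (ν := (volume : Measure ℝ)) hset).2
    (ae_of_all _ fun t => ae_tendsto_averagedExp (by linarith) hK.le hβ hw_meas hw_indep hw_mean
      hw_var (fun a => (hw_mom a).1) (fun a => (hw_mom a).2) t)
  obtain ⟨C, -, hC⟩ := exists_overlap_bound hβ
  obtain ⟨m₀, hm₀⟩ := eventually_atTop.1 hC
  filter_upwards [hae] with ω hω
  -- From this index on paths exist and the quenched laws are probability measures; the 2 comes from
  -- N = m + 2.
  rw [← tendsto_add_atTop_iff_nat (m₀ + 2)]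
  have hprob : ∀ j, IsProbabilityMeasure
      (quenchedLaw β (fun a => w a ω) (j + m₀ + 2) : Measure ℝ) := fun j =>
    isProbabilityMeasure_quenchedLaw _ (hm₀ (j + m₀) (Nat.le_add_left _ _)).1
  have hgauss : ∀ t : ℝ, charFun (gaussianReal 0 1) t = (Real.exp (-(t ^ 2 / 2)) : ℝ) := fun t => by
    rw [charFun_gaussianReal]
    push_cast
    congr 1
    simp
  have hchar := tendsto_charFun_of_ae (μ₀ := gaussianReal 0 1)
    (μ := fun j => (quenchedLaw β (fun a => w a ω) (j + m₀ + 2) : Measure ℝ)) (by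
      filter_upwards [hω] with t ht
      rw [hgauss]
      refine ((tendsto_add_atTop_iff_nat m₀).2 ht).congr fun j => ?_
      exact (charFun_quenchedLaw β (fun a => w a ω) (j + m₀) t).symm)
  have hconv := ProbabilityMeasure.tendsto_of_tendsto_charFun
    (μ := fun j => (⟨_, hprob j⟩ : ProbabilityMeasure ℝ))
    (μ₀ := ⟨gaussianReal 0 1, inferInstance⟩) hchar
  exact (ProbabilityMeasure.tendsto_nhds_iff_toFiniteMeasure_tendsto_nhds _).1 hconv
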